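/- Let $(\mathcal N,\mathcal A,\mathcal S)$ be a network with finite node set $\mathcal N$, arcs $\mathcal A\subseteq\mathcal N\times\mathcal N$ ($(j,i)\in\mathcal A$ means that $i$ can receive data from $j$), in-neighbours $\mathcal N_i=\{j\neq i:(j,i)\in\mathcal A\}$, and sensor nodes $\mathcal S\subseteq\mathcal N$. Let $$x_{k+1}=Ax_k+w_k,\qquad y^i_k=C^ix_k+v^i_k\quad(i\in\mathcal S,\ k=0,1,\dots),$$ with $x_k\in\mathbb R^n$, where $x_0$ and all $w_k$, $v^i_k$ are mutually independent, $x_0$ is Gaussian with positive definite covariance, $w_k\sim\mathcal N(0,Q)$, $v^i_k\sim\mathcal N(0,R^i)$, and $Q$, $R^i$ are positive definite. Let $\pi_{i,i}>0$ and $\pi_{i,j}>0$ ($j\in\mathcal N_i$) be weights with $\pi_{i,i}+\sum_{j\in\mathcal N_i}\pi_{i,j}=1$, and let $L\ge1$ be an integer, $\tau>0$ and $\delta\ge0$. An information pair $(q,\Omega)$, $\Omega$ positive definite, represents the Gaussian density with mean $\Omega^{-1}q$ and covariance $\Omega^{-1}$. The event-triggered consensus Kalman filter maintains at each node $i$ a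 local pair $(q^i,\Omega^i)$, with mean $\hat x^i$ and covariance $P^i$, and a reference pair $(\bar q^i,\bar\Omega^i)$, which is also known to the out-neighbours of $i$. At each time $k=0,1,\dots$: 1. Correction. If $i\in\mathcal S$, put $q^i_{k|k}=q^i_{k|k-1}+(C^i)^\top(R^i)^{-1}y^i_k$ and $\Omega^i_{k|k}=\Omega^i_{k|k-1}+(C^i)^\top(R^i)^{-1}C^i$; otherwise leave the pair unchanged. 2. Consensus. Start from $(q^i_{k,0},\Omega^i_{k,0})=(q^i_{k|k},\Omega^i_{k|k})$. For $\ell=0,\dots,L-1$, node $i$ transmits its local pair unless the Kullback-Leibler divergence $D_{KL}(p^i_{k,\ell}\,\|\,\bar p^i_{k,\ell})$ of its local density from its reference density is at most $\tau$. Then $$q^i_{k,\ell+1}=\pi_{i,i}q^i_{k,\ell}+\sum_{j\in\mathcal N_i}\pi_{i,j}\hat q^j_{k,\ell},\qquad \Omega^i_{k,\ell+1}=\pi_{i,i}\Omega^i_{k,\ell}+\sum_{j\in\mathcal N_i}\pi_{i,j}\hat\Omega^j_{k,\ell},$$ where $(\hat q^j_{k,\ell},\hat\Omega^j_{k,\ell})=(q^j_{k,\ell},\Omega^j_{k,\ell})$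 if $j$ transmits and $(\hat q^j_{k,\ell},\hat\Omega^j_{k,\ell})=\frac1{1+\delta}(\bar q^j_{k,\ell},\bar\Omega^j_{k,\ell})$ otherwise. The next reference pair $(\bar q^i_{k,\ell+1},\bar\Omega^i_{k,\ell+1})$ is $(q^i_{k,\ell},\Omega^i_{k,\ell})$ if $i$ transmits and $(\bar q^i_{k,\ell},\bar\Omega^i_{k,\ell})$ otherwise. 3. Prediction. The local pair $(q^i_{k+1|k},\Omega^i_{k+1|k})$ and the reference pair $(\bar q^i_{k+1,0},\bar\Omega^i_{k+1,0})$ represent the Gaussians obtained from those of $(q^i_{k,L},\Omega^i_{k,L})$ and $(\bar q^i_{k,L},\bar\Omega^i_{k,L})$ by replacing mean $\hat x$ and covariance $P$ with $A\hat x$ and $APA^\top+Q$. The filter starts from arbitrary deterministic pairs $(q^i_{0|-1},\Omega^i_{0|-1})$ with $\Omega^i_{0|-1}$ positive definite. At the start each node either has an arbitrary deterministic reference pair with positive definite information matrix, or has no reference, in which case it transmits at the first consensus step. Let $\delta^*(\tau)=\overline\lambda(\tau)-1$, where $\overline\lambda(\tau)>1$ is the larger solution of $\lambda-\log\lambda-1=2\tau$.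 **Theorem 1.** Suppose that $A$ is invertible, that the pair $(A,C)$ with $C=\mathrm{col}(C^i;\,i\in\mathcal S)$ is observable, that the network is strongly connected, and that $\delta\ge\delta^*(\tau)$. Then, in each node $i\in\mathcal N$, the estimates $\hat x^i_{k|k}=(\Omega^i_{k|k})^{-1}q^i_{k|k}$ satisfy $$\limsup_{k\to\infty}\mathbb E\{\|\hat x^i_{k|k}-x_k\|^2\}<+\infty .$$ -/

import Mathlib

open MeasureTheory ProbabilityTheory InformationTheory Filter
open scoped Matrix ENNReal

noncomputable section

/-- A Gaussian density on `ℝⁿ`, represented by its information pair: information vector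
`q = Ω x̂` and information matrix `Ω = P⁻¹`, for mean `x̂` and covariance `P`. -/
structure InfoPair (n : ℕ) where
  /-- the information vector -/
  q : Fin n → ℝ
  /-- the information matrix -/
  Om : Matrix (Fin n) (Fin n) ℝ

namespace InfoPair

variable {n : ℕ}

/-- The covariance `P = Ω⁻¹`. -/
def cov (p : InfoPair n) : Matrix (Fin n) (Fin n) ℝ := p.Om⁻¹

/-- The mean `x̂ = Ω⁻¹ q`, i.e. the point estimate. -/
def mean (p : InfoPair n) : EuclideanSpace ℝ (Fin n) := WithLp.toLp 2 (p.Om⁻¹ *ᵥ p.q)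

/-- The Gaussian distribution represented by an information pair. -/
def law (p : InfoPair n) : Measure (EuclideanSpace ℝ (Fin n)) :=
  multivariateGaussian p.mean p.cov

/-- Kalman filter correction with a measurement `y = C x + v`, `v ∼ N(0, R)`. -/
def correct {m : ℕ} (C : Matrix (Fin m) (Fin n) ℝ) (R : Matrix (Fin m) (Fin m) ℝ)
    (y : EuclideanSpace ℝ (Fin m)) (p : InfoPair n) : InfoPair n where
  q := p.q + Cᵀ *ᵥ (R⁻¹ *ᵥ y.ofLp)
  Om := p.Om + Cᵀ * R⁻¹ * C

/-- Kalman filter prediction for `x⁺ = A x + w`, `w ∼ N(0, Q)`: the mean becomes `A x̂` and the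
covariance becomes `A P Aᵀ + Q`. -/
def predict (A Q : Matrix (Fin n) (Fin n) ℝ) (p : InfoPair n) : InfoPair n where
  q := (A * p.cov * Aᵀ + Q)⁻¹ *ᵥ (A *ᵥ p.mean.ofLp)
  Om := (A * p.cov * Aᵀ + Q)⁻¹

/-- Flattening: the mean is kept and the covariance is multiplied by `1 + δ`. -/
def flatten (δ : ℝ) (p : InfoPair n) : InfoPair n where
  q := (1 / (1 + δ)) • p.q
  Om := (1 / (1 + δ)) • p.Om

end InfoPair

/-- The in-neighbours `𝒩_i` of node `i` (other than `i` itself); an arc from `j` to `i` means that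
`i` can receive data from `j`. -/
def inNeighbors {ι : Type*} [Fintype ι] (G : Digraph ι) (i : ι) : Finset ι :=
  open scoped Classical in Finset.univ.filter (fun j => j ≠ i ∧ G.Adj j i)

/-- There is a directed path from any node to any other node. -/
def StronglyConnected {ι : Type*} (G : Digraph ι) : Prop :=
  ∀ i j : ι, Relation.ReflTransGen G.Adj i j

/-- Consensus weights: positive on the node itself and on its in-neighbours, with sum one. -/
structure IsConsensusWeights {ι : Type*} [Fintype ι] (G : Digraph ι) (W : ι → ι → ℝ) : Prop where
  self_pos : ∀ i, 0 < W i i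
  neighbor_pos : ∀ i, ∀ j ∈ inNeighbors G i, 0 < W i j
  sum_eq_one : ∀ i, W i i + ∑ j ∈ inNeighbors G i, W i j = 1

/-- The stacked output matrix `col(C^i ; i ∈ S)`. -/
def stackedOutput {ι : Type*} {n : ℕ} {m : ι → ℕ} (S : Finset ι)
    (C : (i : ι) → Matrix (Fin (m i)) (Fin n) ℝ) :
    Matrix (Σ i : S, Fin (m i)) (Fin n) ℝ :=
  Matrix.of fun r c => C r.1 r.2 c

/-- The observability matrix `col(C, C A, …, C A^(n-1))`. -/
def observabilityMatrix {n : ℕ} {p : Type*} (A : Matrix (Fin n) (Fin n) ℝ)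
    (C : Matrix p (Fin n) ℝ) : Matrix (Fin n × p) (Fin n) ℝ :=
  Matrix.of fun r c => (C * A ^ (r.1 : ℕ)) r.2 c

/-- The pair `(A, C)` is observable. -/
def IsObservable {n : ℕ} {p : Type*} (A : Matrix (Fin n) (Fin n) ℝ)
    (C : Matrix p (Fin n) ℝ) : Prop :=
  (observabilityMatrix A C).rank = n

/-- The data held by the network: each node's local density, and each node's reference density,
which is the most recently transmitted density propagated to the current time (`none` as long as
there is no reference). A node's reference density is known to the node and its out-neighbours. -/
structure NetState (ι : Type*) (n : ℕ) where
  /-- local densities -/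
  cur : ι → InfoPair n
  /-- reference densities -/
  ref : ι → Option (InfoPair n)

namespace NetState

variable {ι : Type*} {n : ℕ}

/-- The event-triggered transmission test: node `i` does not transmit iff the Kullback-Leibler
divergence of its local density from its reference density is at most `τ`. A node without a
reference transmits. -/
def Transmits (τ : ℝ) (s : NetState ι n) (i : ι) : Prop :=
  match s.ref i with
  | none => True
  | some r => ¬ klDiv (s.cur i).law r.law ≤ ENNReal.ofReal τ

/-- What the out-neighbours of `j` use as the density of `j` in the fusion: the local density if
`j` transmits, and the flattened reference density otherwise. -/
def received (τ δ : ℝ) (s : NetState ι n) (j : ι) : InfoPair n :=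
  open scoped Classical in
  if s.Transmits τ j then s.cur j else ((s.ref j).getD (s.cur j)).flatten δ

/-- One event-triggered consensus step. -/
def consensusStep [Fintype ι] (G : Digraph ι) (W : ι → ι → ℝ) (τ δ : ℝ) (s : NetState ι n) :
    NetState ι n where
  cur i :=
    { q := W i i • (s.cur i).q + ∑ j ∈ inNeighbors G i, W i j • (s.received τ δ j).q
      Om := W i i • (s.cur i).Om + ∑ j ∈ inNeighbors G i, W i j • (s.received τ δ j).Om }
  ref i := open scoped Classical in if s.Transmits τ i then some (s.cur i) else s.ref i

/-- The correction step, performed by the sensor nodes `i ∈ S` only. -/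
def correctStep {m : ι → ℕ} (S : Finset ι) (C : (i : ι) → Matrix (Fin (m i)) (Fin n) ℝ)
    (R : (i : ι) → Matrix (Fin (m i)) (Fin (m i)) ℝ)
    (y : (i : ι) → EuclideanSpace ℝ (Fin (m i))) (s : NetState ι n) : NetState ι n where
  cur i := open scoped Classical in
    if i ∈ S then (s.cur i).correct (C i) (R i) (y i) else s.cur i
  ref := s.ref

/-- The prediction step, for local and reference densities. -/
def predictStep (A Q : Matrix (Fin n) (Fin n) ℝ) (s : NetState ι n) : NetState ι n where
  cur i := (s.cur i).predict A Q
  ref i := (s.ref i).map (InfoPair.predict A Q)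

end NetState

/-- The data of a run of the event-triggered distributed Kalman filter. -/
structure ETFilter (ι : Type*) [Fintype ι] (n : ℕ) (m : ι → ℕ) where
  /-- the network -/
  G : Digraph ι
  /-- the set of sensor nodes -/
  S : Finset ι
  /-- the consensus weights -/
  W : ι → ι → ℝ
  /-- the number of consensus steps -/
  L : ℕ
  /-- the triggering threshold -/
  τ : ℝ
  /-- the flattening parameter -/
  δ : ℝ
  /-- the system matrix -/
  A : Matrix (Fin n) (Fin n) ℝ
  /-- the covariance of the process disturbance -/
  Q : Matrix (Fin n) (Fin n) ℝ
  /-- the output matrices -/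
  C : (i : ι) → Matrix (Fin (m i)) (Fin n) ℝ
  /-- the covariances of the measurement noises -/
  R : (i : ι) → Matrix (Fin (m i)) (Fin (m i)) ℝ
  /-- the initial priors and the initial references (if any) -/
  init : NetState ι n

namespace ETFilter

variable {ι : Type*} [Fintype ι] {n : ℕ} {m : ι → ℕ}

/-- The network data at the start of time `k` (local priors `p_{k|k-1}`, references `p̄_{k,0}`),
for the measurement record `y`. -/
def prior (F : ETFilter ι n m) (y : ℕ → (i : ι) → EuclideanSpace ℝ (Fin (m i))) :
    ℕ → NetState ι n
  | 0 => F.init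
  | k + 1 =>
    (((NetState.consensusStep F.G F.W F.τ F.δ)^[F.L]
      ((prior F y k).correctStep F.S F.C F.R (y k)))).predictStep F.A F.Q

/-- The network data after the correction at time `k` (local posteriors `p_{k|k}`). -/
def posterior (F : ETFilter ι n m) (y : ℕ → (i : ι) → EuclideanSpace ℝ (Fin (m i))) (k : ℕ) :
    NetState ι n :=
  (F.prior y k).correctStep F.S F.C F.R (y k)

/-- The estimate `x̂^i_{k|k}`. -/
def estimate (F : ETFilter ι n m) (y : ℕ → (i : ι) → EuclideanSpace ℝ (Fin (m i))) (k : ℕ)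
    (i : ι) : EuclideanSpace ℝ (Fin n) :=
  ((F.posterior y k).cur i).mean

end ETFilter

/-- Labels of the primitive random variables: the initial state, the process disturbances, and
the measurement noises of the sensor nodes. -/
inductive NoiseIndex {ι : Type*} (S : Finset ι) where
  | init : NoiseIndex S
  | process (k : ℕ) : NoiseIndex S
  | sensor (i : S) (k : ℕ) : NoiseIndex S

/-- Dimension of each primitive random variable. -/
def NoiseIndex.dim {ι : Type*} {S : Finset ι} (n : ℕ) (m : ι → ℕ) : NoiseIndex S → ℕ
  | .init => n
  | .process _ => n
  | .sensor i _ => m i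

/-- The family of all primitive random variables. -/
def noiseFamily {ι Ω : Type*} {n : ℕ} {m : ι → ℕ} (S : Finset ι)
    (x₀ : Ω → EuclideanSpace ℝ (Fin n)) (w : ℕ → Ω → EuclideanSpace ℝ (Fin n))
    (v : (i : ι) → ℕ → Ω → EuclideanSpace ℝ (Fin (m i))) :
    (a : NoiseIndex S) → Ω → EuclideanSpace ℝ (Fin (a.dim n m))
  | .init => x₀
  | .process k => w k
  | .sensor i k => v i k

/-- `δ*(τ) = λ - 1`, where `λ` is the solution of `λ - log λ - 1 = 2 τ` with `λ > 1`. -/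
def deltaStar (τ : ℝ) : ℝ := sSup {l : ℝ | 1 < l ∧ l - Real.log l - 1 = 2 * τ} - 1

/-- For `τ > 0` the solution of `λ - log λ - 1 = 2 τ` with `λ > 1` exists, is unique, and equals
`1 + deltaStar τ`. -/
theorem deltaStar_spec {τ : ℝ} (hτ : 0 < τ) (l : ℝ) :
    (1 < l ∧ l - Real.log l - 1 = 2 * τ) ↔ l = 1 + deltaStar τ := by
  have hmono : StrictMonoOn (fun l : ℝ => l - Real.log l - 1) (Set.Ici 1) := by
    intro a ha b hb hab
    have ha' : (1 : ℝ) ≤ a := ha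
    have ha0 : 0 < a := by linarith
    have h1 : Real.log (b / a) < b / a - 1 := by
      apply Real.log_lt_sub_one_of_pos
      · apply div_pos <;> linarith
      · intro h
        rw [div_eq_one_iff_eq ha0.ne'] at h
        linarith
    rw [Real.log_div (by linarith) ha0.ne'] at h1
    have h2 : b / a - 1 ≤ b - a := by
      rw [div_sub_one ha0.ne', div_le_iff₀ ha0]
      nlinarith
    simp only
    linarith
  have hex : ∃ l : ℝ, 1 < l ∧ l - Real.log l - 1 = 2 * τ := by
    have hc : ContinuousOn (fun l : ℝ => l - Real.log l - 1)
        (Set.Icc 1 (8 * (1 + τ))) := by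
      apply ContinuousOn.sub _ continuousOn_const
      apply continuousOn_id.sub
      apply Real.continuousOn_log.mono
      intro x hx
      have : (1 : ℝ) ≤ x := hx.1
      simp only [Set.mem_compl_iff, Set.mem_singleton_iff]
      linarith
    have hlog : Real.log (8 * (1 + τ)) ≤ 2 * (1 + τ) + 3 := by
      have h4 : Real.log ((8 * (1 + τ)) / 4) ≤ (8 * (1 + τ)) / 4 - 1 :=
        Real.log_le_sub_one_of_pos (by linarith)
      rw [Real.log_div (by linarith) (by norm_num)] at h4
      have h5 : Real.log 4 ≤ 4 - 1 := Real.log_le_sub_one_of_pos (by norm_num)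
      linarith
    have hmem : 2 * τ ∈ Set.Icc ((fun l : ℝ => l - Real.log l - 1) 1)
        ((fun l : ℝ => l - Real.log l - 1) (8 * (1 + τ))) := by
      constructor
      · simp only [Real.log_one]
        linarith
      · simp only
        linarith
    obtain ⟨l, hl, hl'⟩ := intermediate_value_Icc (by linarith) hc hmem
    refine ⟨l, lt_of_le_of_ne hl.1 ?_, hl'⟩
    rintro rfl
    simp at hl'
    linarith
  obtain ⟨l₀, h₀, h₀'⟩ := hex
  have hset : {l : ℝ | 1 < l ∧ l - Real.log l - 1 = 2 * τ} = {l₀} := by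
    ext l
    rw [Set.mem_singleton_iff]
    constructor
    · rintro ⟨h1, h2⟩
      exact hmono.injOn (Set.mem_Ici.2 h1.le) (Set.mem_Ici.2 h₀.le) (h2.trans h₀'.symm)
    · rintro rfl
      exact ⟨h₀, h₀'⟩
  have hd : 1 + deltaStar τ = l₀ := by
    rw [deltaStar, hset, csSup_singleton]
    ring
  rw [hd]
  exact Set.ext_iff.1 hset l

end

/-! The argument follows, along each noise path, one number `M k` bounding the errors of all nodes
in the information norm: `‖x̂ - x‖_Ω ≤ M k`. It is written dually (`ErrBound`), through `u ⬝ᵥ (q - Ω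
x)` against `√(uᵀΩu)`, because `q` and `Ω` are what the filter adds up.

Silence costs little. Since divergence decreases under the projections `z ↦ uᵀz`, a divergence of at
most `τ` gives `P ≤ (1 + δ*) P̄`, `P̄ ≤ e^(1+2τ) P` and a mean difference of at most `√(2τ)` in the
`P̄⁻¹`-norm. As `δ ≥ δ*`, flattening makes the substituted information at most the true one, and the
error bound grows only by the additive `√(2τ)` (`errBound_received`). Concavity of the square root
carries this through fusion.

Prediction contracts. If `Ω ≥ α I`, then `A P Aᵀ ≤ κ Q` for some `κ`, so `M` is multiplied by some
`γ < 1`, up to the size of the disturbance (`exists_errBound_predict`).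

The bound `Ω ≥ α I` must be uniform in time and in the data, since transmissions depend on the data
(`exists_le_quadVal_posterior`). Information is bounded above by `Q⁻¹` plus a correction, so with
`A` invertible a prediction keeps a fixed fraction of it; a consensus step also passes a fixed
fraction along each arc. Strong connectivity brings the measurements of every sensor to every node,
and observability makes their sum definite.

Hence `M (k+1) = γ M k + b k`, where `b k` is affine in noise norms and has bounded second moment.
So `E[M k ^ 2]` is bounded, and `Ω ≥ α I` converts this into the Euclidean error. -/

/-! ### Quadratic forms, Cauchy-Schwarz inequalities and order reversal under inversion. -/

noncomputable section QuadraticForms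

namespace Matrix

variable {κ ρ : Type*} [Fintype κ] [Fintype ρ]

/-- The value `uᵀ M u` of the quadratic form of a matrix. -/
def quadVal (M : Matrix κ κ ℝ) (u : κ → ℝ) : ℝ := u ⬝ᵥ M *ᵥ u

theorem quadVal_add (M N : Matrix κ κ ℝ) (u : κ → ℝ) :
    (M + N).quadVal u = M.quadVal u + N.quadVal u := by
  simp [quadVal, add_mulVec]

theorem quadVal_smul (c : ℝ) (M : Matrix κ κ ℝ) (u : κ → ℝ) :
    (c • M).quadVal u = c * M.quadVal u := by
  simp [quadVal, smul_mulVec]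

theorem quadVal_sum {α : Type*} (s : Finset α) (M : α → Matrix κ κ ℝ) (u : κ → ℝ) :
    (∑ a ∈ s, M a).quadVal u = ∑ a ∈ s, (M a).quadVal u := by
  simp [quadVal, sum_mulVec, dotProduct_sum]

theorem quadVal_transpose_mul_mul (B : Matrix ρ κ ℝ) (M : Matrix ρ ρ ℝ) (u : κ → ℝ) :
    (Bᵀ * M * B).quadVal u = M.quadVal (B *ᵥ u) := by
  simp [quadVal, ← mulVec_mulVec, dotProduct_mulVec, vecMul_transpose]

theorem quadVal_mul_mul_transpose (B : Matrix ρ κ ℝ) (M : Matrix κ κ ℝ) (u : ρ → ℝ) :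
    (B * M * Bᵀ).quadVal u = M.quadVal (Bᵀ *ᵥ u) := by
  simpa using quadVal_transpose_mul_mul Bᵀ M u

theorem PosSemidef.quadVal_nonneg {M : Matrix κ κ ℝ} (hM : M.PosSemidef) (u : κ → ℝ) :
    0 ≤ M.quadVal u := by
  simpa [quadVal] using hM.dotProduct_mulVec_nonneg u

theorem PosDef.quadVal_nonneg {M : Matrix κ κ ℝ} (hM : M.PosDef) (u : κ → ℝ) :
    0 ≤ M.quadVal u := hM.posSemidef.quadVal_nonneg u

theorem PosDef.quadVal_pos {M : Matrix κ κ ℝ} (hM : M.PosDef) {u : κ → ℝ} (hu : u ≠ 0) :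
    0 < M.quadVal u := by
  simpa [quadVal] using hM.dotProduct_mulVec_pos hu

theorem dotProduct_self_nonneg' (u : κ → ℝ) : 0 ≤ u ⬝ᵥ u :=
  Finset.sum_nonneg fun i _ => mul_self_nonneg (u i)

theorem PosSemidef.dotProduct_mulVec_symm {M : Matrix κ κ ℝ} (hM : M.PosSemidef) (u v : κ → ℝ) :
    u ⬝ᵥ M *ᵥ v = v ⬝ᵥ M *ᵥ u := by
  have h : Mᵀ = M := by simpa using hM.isHermitian.eq
  rw [dotProduct_mulVec, ← mulVec_transpose, h, dotProduct_comm]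

/-- The Cauchy-Schwarz inequality for a positive semidefinite matrix. -/
theorem PosSemidef.sq_dotProduct_mulVec_le {M : Matrix κ κ ℝ} (hM : M.PosSemidef)
    (u v : κ → ℝ) : (u ⬝ᵥ M *ᵥ v) ^ 2 ≤ M.quadVal u * M.quadVal v := by
  have h : ∀ t : ℝ, 0 ≤ M.quadVal v * (t * t) + (2 * (u ⬝ᵥ M *ᵥ v)) * t + M.quadVal u := by
    intro t
    have h0 := hM.quadVal_nonneg (u + t • v)
    have h1 := hM.dotProduct_mulVec_symm u v
    simp only [quadVal, mulVec_add, mulVec_smul, add_dotProduct, dotProduct_add,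
      smul_dotProduct, dotProduct_smul, smul_eq_mul] at h0 ⊢
    rw [← h1] at h0
    linarith
  have := discrim_le_zero h
  rw [discrim] at this
  linarith

theorem exists_quadVal_le (M : Matrix κ κ ℝ) :
    ∃ c, 0 < c ∧ ∀ u, M.quadVal u ≤ c * (u ⬝ᵥ u) := by
  refine ⟨∑ i, ∑ j, |M i j| + 1, by positivity, fun u => ?_⟩
  have hu : ∀ i, u i * u i ≤ u ⬝ᵥ u := fun i =>
    Finset.single_le_sum (f := fun i => u i * u i) (fun i _ => mul_self_nonneg _)
      (Finset.mem_univ i)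
  have h : M.quadVal u ≤ (∑ i, ∑ j, |M i j|) * (u ⬝ᵥ u) := by
    generalize u ⬝ᵥ u = s at hu ⊢
    simp only [quadVal, dotProduct, mulVec, Finset.mul_sum, Finset.sum_mul]
    refine Finset.sum_le_sum fun i _ => Finset.sum_le_sum fun j _ => ?_
    have h1 : u i * (M i j * u j) ≤ |M i j| * |u i * u j| := by
      rw [← abs_mul]
      refine le_trans (le_abs_self _) (le_of_eq ?_)
      congr 1
      ring
    refine h1.trans (mul_le_mul_of_nonneg_left ?_ (abs_nonneg _))
    have h2 := hu i
    have h3 := hu j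
    rw [abs_le]
    constructor <;> nlinarith [sq_nonneg (u i - u j), sq_nonneg (u i + u j)]
  have := dotProduct_self_nonneg' u
  linarith

theorem exists_mulVec_le (B : Matrix ρ κ ℝ) :
    ∃ c, 0 < c ∧ ∀ u, (B *ᵥ u) ⬝ᵥ (B *ᵥ u) ≤ c * (u ⬝ᵥ u) := by
  obtain ⟨c, hc, h⟩ := exists_quadVal_le (Bᵀ * B)
  refine ⟨c, hc, fun u => ?_⟩
  have h1 := h u
  simpa [quadVal, ← mulVec_mulVec, dotProduct_mulVec, vecMul_transpose] using h1

variable [DecidableEq κ]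

theorem PosDef.mul_inv_cancel' {M : Matrix κ κ ℝ} (hM : M.PosDef) : M * M⁻¹ = 1 :=
  mul_nonsing_inv _ ((isUnit_iff_isUnit_det M).1 hM.isUnit)

theorem PosDef.inv_mul_cancel' {M : Matrix κ κ ℝ} (hM : M.PosDef) : M⁻¹ * M = 1 :=
  nonsing_inv_mul _ ((isUnit_iff_isUnit_det M).1 hM.isUnit)

theorem PosDef.mulVec_inv_mulVec {M : Matrix κ κ ℝ} (hM : M.PosDef) (u : κ → ℝ) :
    M *ᵥ (M⁻¹ *ᵥ u) = u := by
  rw [mulVec_mulVec, hM.mul_inv_cancel', one_mulVec]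

theorem PosDef.inv_mulVec_mulVec {M : Matrix κ κ ℝ} (hM : M.PosDef) (u : κ → ℝ) :
    M⁻¹ *ᵥ (M *ᵥ u) = u := by
  rw [mulVec_mulVec, hM.inv_mul_cancel', one_mulVec]

theorem PosDef.inv_inv' {M : Matrix κ κ ℝ} (hM : M.PosDef) : M⁻¹⁻¹ = M :=
  nonsing_inv_nonsing_inv _ ((isUnit_iff_isUnit_det M).1 hM.isUnit)

theorem PosDef.quadVal_inv_mulVec {M : Matrix κ κ ℝ} (hM : M.PosDef) (u : κ → ℝ) :
    M.quadVal (M⁻¹ *ᵥ u) = M⁻¹.quadVal u := by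
  rw [quadVal, hM.mulVec_inv_mulVec, dotProduct_comm, quadVal]

theorem PosDef.quadVal_mulVec_inv {M : Matrix κ κ ℝ} (hM : M.PosDef) (u : κ → ℝ) :
    M⁻¹.quadVal (M *ᵥ u) = M.quadVal u := by
  rw [quadVal, hM.inv_mulVec_mulVec, dotProduct_comm, quadVal]

theorem PosDef.sq_dotProduct_le {M : Matrix κ κ ℝ} (hM : M.PosDef) (u v : κ → ℝ) :
    (u ⬝ᵥ v) ^ 2 ≤ M.quadVal u * M⁻¹.quadVal v := by
  have := hM.posSemidef.sq_dotProduct_mulVec_le u (M⁻¹ *ᵥ v)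
  rwa [hM.mulVec_inv_mulVec, hM.quadVal_inv_mulVec] at this

theorem PosDef.abs_dotProduct_le {M : Matrix κ κ ℝ} (hM : M.PosDef) (u v : κ → ℝ) :
    |u ⬝ᵥ v| ≤ √(M⁻¹.quadVal v) * √(M.quadVal u) := by
  rw [← Real.sqrt_mul (hM.inv.quadVal_nonneg v), mul_comm]
  exact Real.abs_le_sqrt (hM.sq_dotProduct_le u v)

/-- Coercivity comes from `|u|⁴ ≤ M(u) M⁻¹(u)` and the upper bound on `M⁻¹`, without eigenvalues. -/
theorem PosDef.exists_le_quadVal {M : Matrix κ κ ℝ} (hM : M.PosDef) :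
    ∃ c, 0 < c ∧ ∀ u, c * (u ⬝ᵥ u) ≤ M.quadVal u := by
  obtain ⟨c, hc, h⟩ := exists_quadVal_le M⁻¹
  refine ⟨c⁻¹, inv_pos.2 hc, fun u => ?_⟩
  rcases (dotProduct_self_nonneg' u).eq_or_lt with h0 | h0
  · rw [← h0, mul_zero]
    exact hM.quadVal_nonneg u
  · have h1 := hM.sq_dotProduct_le u u
    have h2 : (u ⬝ᵥ u) ^ 2 ≤ M.quadVal u * (c * (u ⬝ᵥ u)) :=
      h1.trans (mul_le_mul_of_nonneg_left (h u) (hM.quadVal_nonneg u))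
    rw [inv_mul_le_iff₀ hc]
    nlinarith

/-- Cauchy-Schwarz at `N⁻¹ u` and `u` gives `N⁻¹(u)² ≤ M(N⁻¹ u) M⁻¹(u) ≤ c N⁻¹(u) M⁻¹(u)`; divide by
`N⁻¹(u)`. -/
theorem quadVal_inv_le_of_quadVal_le {M N : Matrix κ κ ℝ} (hM : M.PosDef) (hN : N.PosDef) {c : ℝ}
    (h : ∀ v, M.quadVal v ≤ c * N.quadVal v) (u : κ → ℝ) :
    N⁻¹.quadVal u ≤ c * M⁻¹.quadVal u := by
  by_cases hu : u = 0
  · simp [hu, quadVal]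
  have h1 := hM.sq_dotProduct_le (N⁻¹ *ᵥ u) u
  have h2 : N.quadVal (N⁻¹ *ᵥ u) = N⁻¹.quadVal u := hN.quadVal_inv_mulVec u
  have h3 : (N⁻¹ *ᵥ u) ⬝ᵥ u = N⁻¹.quadVal u := by rw [dotProduct_comm, quadVal]
  rw [h3] at h1
  have h4 := h (N⁻¹ *ᵥ u)
  rw [h2] at h4
  have h5 := hN.inv.quadVal_pos hu
  have h6 := hM.inv.quadVal_nonneg u
  nlinarith [mul_le_mul_of_nonneg_right h4 h6]

theorem PosDef.exists_inv_quadVal_le {M : Matrix κ κ ℝ} (hM : M.PosDef) :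
    ∃ c, 0 < c ∧ ∀ u, u ⬝ᵥ u ≤ c * M.quadVal u := by
  obtain ⟨c, hc, h⟩ := hM.exists_le_quadVal
  exact ⟨c⁻¹, inv_pos.2 hc, fun u => by rw [inv_mul_eq_div, le_div_iff₀' hc]; exact h u⟩

end Matrix

end QuadraticForms

/-! ### What a small Kullback-Leibler divergence says about two Gaussians. -/

noncomputable section GaussianDivergence

open scoped NNReal

theorem llr_gaussianReal (m m' : ℝ) {v v' : ℝ≥0} (hv : v ≠ 0) (hv' : v' ≠ 0) :
    llr (gaussianReal m v) (gaussianReal m' v') =ᵐ[gaussianReal m v] fun x =>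
      -Real.log (v / v') / 2 - (x - m) ^ 2 / (2 * v) + (x - m') ^ 2 / (2 * v') := by
  have hac : gaussianReal m v ≪ gaussianReal m' v' :=
    (gaussianReal_absolutelyContinuous m hv).trans (gaussianReal_absolutelyContinuous' m' hv')
  have h1 := hac.ae_le (Measure.rnDeriv_eq_div (gaussianReal_absolutelyContinuous m hv)
    (gaussianReal_absolutelyContinuous m' hv'))
  have h2 := (gaussianReal_absolutelyContinuous m hv).ae_le (rnDeriv_gaussianReal m v)
  have h3 := (gaussianReal_absolutelyContinuous m hv).ae_le (rnDeriv_gaussianReal m' v')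
  filter_upwards [h1, h2, h3] with x h1 h2 h3
  have hv0 : (0 : ℝ) < v := by positivity
  have hv0' : (0 : ℝ) < v' := by positivity
  have hpi : 0 < 2 * Real.pi := by positivity
  rw [llr, h1, h2, h3, ENNReal.toReal_div, toReal_gaussianPDF, toReal_gaussianPDF,
    Real.log_div (gaussianPDFReal_pos _ _ _ hv).ne' (gaussianPDFReal_pos _ _ _ hv').ne',
    gaussianPDFReal, gaussianPDFReal, Real.log_mul (by positivity) (Real.exp_pos _).ne',
    Real.log_mul (by positivity) (Real.exp_pos _).ne', Real.log_exp, Real.log_exp, Real.log_inv,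
    Real.log_inv, Real.log_sqrt (by positivity), Real.log_sqrt (by positivity),
    Real.log_mul hpi.ne' hv0.ne', Real.log_mul hpi.ne' hv0'.ne', Real.log_div hv0.ne' hv0'.ne']
  ring

theorem integral_sq_sub_gaussianReal (m c : ℝ) (v : ℝ≥0) :
    Integrable (fun x => (x - c) ^ 2) (gaussianReal m v) ∧
      ∫ x, (x - c) ^ 2 ∂gaussianReal m v = v + (m - c) ^ 2 := by
  have hL : MemLp (fun x : ℝ => x) 2 (gaussianReal m v) := memLp_id_gaussianReal 2
  have h1 : ∀ a : ℝ, Integrable (fun x => (x - a) ^ 2) (gaussianReal m v) := fun a =>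
    (hL.sub (memLp_const a)).integrable_sq
  have hi : Integrable (fun x : ℝ => x) (gaussianReal m v) := hL.integrable (by norm_num)
  have hvar : ∫ x, (x - m) ^ 2 ∂gaussianReal m v = v := by
    have := variance_fun_id_gaussianReal (μ := m) (v := v)
    rwa [variance_eq_integral (by fun_prop), integral_id_gaussianReal] at this
  refine ⟨h1 c, ?_⟩
  have h2 : (fun x : ℝ => (x - c) ^ 2) =
      fun x => (x - m) ^ 2 + (2 * (m - c) * x + ((m - c) ^ 2 - 2 * (m - c) * m)) := by
    ext x
    ring
  have h3 : Integrable (fun x => 2 * (m - c) * x + ((m - c) ^ 2 - 2 * (m - c) * m))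
      (gaussianReal m v) := (hi.const_mul _).add (integrable_const _)
  rw [h2, integral_add (h1 m) h3, hvar,
    integral_add (hi.const_mul _) (integrable_const _), integral_const_mul,
    integral_id_gaussianReal]
  simp

theorem toReal_klDiv_gaussianReal (m m' : ℝ) {v v' : ℝ≥0} (hv : v ≠ 0) (hv' : v' ≠ 0) :
    (klDiv (gaussianReal m v) (gaussianReal m' v')).toReal =
      ((v : ℝ) / v' - 1 - Real.log (v / v') + (m - m') ^ 2 / v') / 2 := by
  have hac : gaussianReal m v ≪ gaussianReal m' v' :=
    (gaussianReal_absolutelyContinuous m hv).trans (gaussianReal_absolutelyContinuous' m' hv')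
  have hv0 : (0 : ℝ) < v := by positivity
  have hv0' : (0 : ℝ) < v' := by positivity
  have h1 := (integral_sq_sub_gaussianReal m m v).1.div_const (2 * (v : ℝ))
  have h2 := (integral_sq_sub_gaussianReal m m' v).1.div_const (2 * (v' : ℝ))
  have hc : Integrable (fun _ : ℝ => -Real.log (v / v') / 2) (gaussianReal m v) :=
    integrable_const _
  have h3 : Integrable (fun x => -Real.log (v / v') / 2 - (x - m) ^ 2 / (2 * (v : ℝ)))
      (gaussianReal m v) := hc.sub h1
  rw [toReal_klDiv_of_measure_eq hac (by simp), integral_congr_ae (llr_gaussianReal m m' hv hv'),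
    integral_add h3 h2, integral_sub hc h1, integral_const, integral_div, integral_div,
    (integral_sq_sub_gaussianReal m m v).2, (integral_sq_sub_gaussianReal m m' v).2]
  simp only [probReal_univ, smul_eq_mul]
  field_simp
  ring

theorem multivariateGaussian_map_dotProduct {n : ℕ} (m : EuclideanSpace ℝ (Fin n))
    {P : Matrix (Fin n) (Fin n) ℝ} (hP : P.PosSemidef) (u : Fin n → ℝ) :
    (multivariateGaussian m P).map (innerSL ℝ (WithLp.toLp 2 u)) =
      gaussianReal (u ⬝ᵥ m.ofLp) (P.quadVal u).toNNReal := by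
  rw [IsGaussian.map_eq_gaussianReal, IsGaussian.integral_dual, integral_id_multivariateGaussian]
  congr 2
  · simp [PiLp.inner_apply, dotProduct, mul_comm]
  · have h := covarianceBilin_self (μ := multivariateGaussian m P) IsGaussian.memLp_two_id
      (WithLp.toLp 2 u)
    rw [covarianceBilin_multivariateGaussian hP] at h
    exact h.symm

/-- Data processing along `z ↦ uᵀz` reduces the divergence to that of two scalar Gaussians, which is
explicit; no multivariate formula with determinants is needed. -/
theorem log_ratio_add_sq_le_of_klDiv_le {n : ℕ} {m m' : EuclideanSpace ℝ (Fin n)}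
    {P P' : Matrix (Fin n) (Fin n) ℝ} (hP : P.PosDef) (hP' : P'.PosDef) {τ : ℝ} (hτ : 0 ≤ τ)
    (h : klDiv (multivariateGaussian m P) (multivariateGaussian m' P') ≤ ENNReal.ofReal τ)
    {u : Fin n → ℝ} (hu : u ≠ 0) :
    P.quadVal u / P'.quadVal u - 1 - Real.log (P.quadVal u / P'.quadVal u) +
      (u ⬝ᵥ (m.ofLp - m'.ofLp)) ^ 2 / P'.quadVal u ≤ 2 * τ := by
  have hm : Measurable (innerSL ℝ (WithLp.toLp 2 u : EuclideanSpace ℝ (Fin n))) := by fun_prop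
  have h1 := (klDiv_map_le (multivariateGaussian m P) (multivariateGaussian m' P') hm).trans h
  rw [multivariateGaussian_map_dotProduct m hP.posSemidef,
    multivariateGaussian_map_dotProduct m' hP'.posSemidef] at h1
  have h2 := ENNReal.toReal_mono ENNReal.ofReal_ne_top h1
  have hp := hP.quadVal_pos hu
  have hp' := hP'.quadVal_pos hu
  rw [ENNReal.toReal_ofReal hτ, toReal_klDiv_gaussianReal _ _ (by simpa using hp)
    (by simpa using hp'), Real.coe_toNNReal _ hp.le, Real.coe_toNNReal _ hp'.le,
    ← dotProduct_sub] at h2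
  linarith

theorem one_lt_one_add_deltaStar {τ : ℝ} (hτ : 0 < τ) : 1 < 1 + deltaStar τ :=
  ((deltaStar_spec hτ _).2 rfl).1

theorem le_one_add_deltaStar {τ l : ℝ} (hτ : 0 < τ) (hl : l - Real.log l - 1 ≤ 2 * τ) :
    l ≤ 1 + deltaStar τ := by
  obtain ⟨h1, h2⟩ := (deltaStar_spec hτ _).2 (rfl : 1 + deltaStar τ = _)
  by_contra! h
  set a := 1 + deltaStar τ
  have ha0 : 0 < a := by linarith
  have h3 : Real.log (l / a) < l / a - 1 := by
    apply Real.log_lt_sub_one_of_pos (by apply div_pos <;> linarith)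
    intro h
    rw [div_eq_one_iff_eq ha0.ne'] at h
    linarith
  rw [Real.log_div (by linarith) ha0.ne'] at h3
  have h4 : l / a - 1 ≤ l - a := by
    rw [div_sub_one ha0.ne', div_le_iff₀ ha0]
    nlinarith
  linarith

variable {n : ℕ} {m m' : EuclideanSpace ℝ (Fin n)} {P P' : Matrix (Fin n) (Fin n) ℝ} {τ : ℝ}

/-- The variance ratio `l` satisfies `l - log l - 1 ≤ 2τ`, so it cannot exceed the larger root. This
constant has to be the exact one, as it is what flattening compensates. -/
theorem quadVal_le_of_klDiv_le (hP : P.PosDef) (hP' : P'.PosDef) (hτ : 0 < τ)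
    (h : klDiv (multivariateGaussian m P) (multivariateGaussian m' P') ≤ ENNReal.ofReal τ)
    (u : Fin n → ℝ) : P.quadVal u ≤ (1 + deltaStar τ) * P'.quadVal u := by
  by_cases hu : u = 0
  · simp [hu, Matrix.quadVal]
  have h1 := log_ratio_add_sq_le_of_klDiv_le hP hP' hτ.le h hu
  have hp' := hP'.quadVal_pos hu
  have h2 : 0 ≤ (u ⬝ᵥ (m.ofLp - m'.ofLp)) ^ 2 / P'.quadVal u := by positivity
  rw [← div_le_iff₀ hp']
  exact le_one_add_deltaStar hτ (by linarith)

/-- A crude bound: dropping the positive ratio `l` leaves `-log l ≤ 1 + 2τ`. Any constant depending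
on `τ` alone would serve, as it only affects how much information survives fusion. -/
theorem quadVal_ge_of_klDiv_le (hP : P.PosDef) (hP' : P'.PosDef) (hτ : 0 < τ)
    (h : klDiv (multivariateGaussian m P) (multivariateGaussian m' P') ≤ ENNReal.ofReal τ)
    (u : Fin n → ℝ) : P'.quadVal u ≤ Real.exp (1 + 2 * τ) * P.quadVal u := by
  by_cases hu : u = 0
  · simp [hu, Matrix.quadVal]
  have h1 := log_ratio_add_sq_le_of_klDiv_le hP hP' hτ.le h hu
  have hp' := hP'.quadVal_pos hu
  have hp := hP.quadVal_pos hu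
  have h2 : 0 ≤ (u ⬝ᵥ (m.ofLp - m'.ofLp)) ^ 2 / P'.quadVal u := by positivity
  have h3 : 0 < P.quadVal u / P'.quadVal u := by positivity
  have h4 : Real.log (P'.quadVal u / P.quadVal u) ≤ 1 + 2 * τ := by
    rw [← inv_div, Real.log_inv]
    linarith
  rw [Real.log_le_iff_le_exp (by positivity)] at h4
  rwa [← div_le_iff₀ hp]

theorem abs_dotProduct_le_of_klDiv_le (hP : P.PosDef) (hP' : P'.PosDef) (hτ : 0 < τ)
    (h : klDiv (multivariateGaussian m P) (multivariateGaussian m' P') ≤ ENNReal.ofReal τ)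
    (u : Fin n → ℝ) : |u ⬝ᵥ (m.ofLp - m'.ofLp)| ≤ √(2 * τ) * √(P'.quadVal u) := by
  by_cases hu : u = 0
  · simp [hu, Matrix.quadVal]
  have h1 := log_ratio_add_sq_le_of_klDiv_le hP hP' hτ.le h hu
  have hp' := hP'.quadVal_pos hu
  have h3 : 0 < P.quadVal u / P'.quadVal u := div_pos (hP.quadVal_pos hu) hp'
  have h4 := Real.log_le_sub_one_of_pos h3
  rw [← Real.sqrt_mul (by positivity)]
  apply Real.abs_le_sqrt
  rw [← div_le_iff₀ hp']
  linarith

end GaussianDivergence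

/-! ### Correction and prediction: effect on information and on the weighted error. -/

noncomputable section FilterSteps

theorem exists_pos_forall_le {α : Type*} [Finite α] (f : α → ℝ) (hf : ∀ a, 0 < f a) :
    ∃ ε, 0 < ε ∧ ∀ a, ε ≤ f a := by
  have h : ∀ᶠ ε in nhdsWithin (0 : ℝ) (Set.Ioi 0), ∀ a, ε ≤ f a :=
    eventually_all.2 fun a => (eventually_le_nhds (hf a)).filter_mono nhdsWithin_le_nhds
  obtain ⟨ε, h1, h2⟩ := (h.and self_mem_nhdsWithin).exists
  exact ⟨ε, h2, h1⟩

namespace InfoPair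

variable {n m : ℕ}

/-- The estimation error of an information pair with respect to the state `x` is at most `M` in
the norm weighted by the information matrix. -/
def ErrBound (p : InfoPair n) (x : Fin n → ℝ) (M : ℝ) : Prop :=
  0 ≤ M ∧ ∀ u, |u ⬝ᵥ (p.q - p.Om *ᵥ x)| ≤ M * √(p.Om.quadVal u)

theorem ErrBound.mono {p : InfoPair n} {x : Fin n → ℝ} {M M' : ℝ} (h : p.ErrBound x M)
    (hM : M ≤ M') : p.ErrBound x M' :=
  ⟨h.1.trans hM, fun u => (h.2 u).trans (mul_le_mul_of_nonneg_right hM (Real.sqrt_nonneg _))⟩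

/-- Testing with `u = Ω⁻¹ v` passes from the information form of the bound to its covariance form.
-/
theorem ErrBound.abs_dotProduct_mean_sub_le {p : InfoPair n} {x : Fin n → ℝ} {M : ℝ}
    (h : p.ErrBound x M) (hp : p.Om.PosDef) (v : Fin n → ℝ) :
    |v ⬝ᵥ (p.mean.ofLp - x)| ≤ M * √(p.cov.quadVal v) := by
  have h1 := h.2 (p.Om⁻¹ *ᵥ v)
  rw [hp.quadVal_inv_mulVec] at h1
  have h2 : (p.Om⁻¹ *ᵥ v) ⬝ᵥ (p.q - p.Om *ᵥ x) = v ⬝ᵥ (p.mean.ofLp - x) := by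
    have h3 : p.mean.ofLp - x = p.Om⁻¹ *ᵥ (p.q - p.Om *ᵥ x) := by
      rw [Matrix.mulVec_sub, hp.inv_mulVec_mulVec]
      rfl
    rw [h3, hp.inv.posSemidef.dotProduct_mulVec_symm, dotProduct_comm]
  rwa [h2] at h1

theorem om_mulVec_mean {p : InfoPair n} (hp : p.Om.PosDef) : p.Om *ᵥ p.mean.ofLp = p.q :=
  hp.mulVec_inv_mulVec p.q

theorem errBound_self {p : InfoPair n} (hp : p.Om.PosDef) (x : Fin n → ℝ) :
    p.ErrBound x (√(p.Om.quadVal (p.mean.ofLp - x))) := by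
  refine ⟨Real.sqrt_nonneg _, fun u => ?_⟩
  have h := hp.abs_dotProduct_le u (p.q - p.Om *ᵥ x)
  rw [← om_mulVec_mean hp, ← Matrix.mulVec_sub, hp.quadVal_mulVec_inv] at h
  rwa [← om_mulVec_mean hp, ← Matrix.mulVec_sub]

theorem quadVal_cov_le {p : InfoPair n} (hp : p.Om.PosDef) {α : ℝ} (hα : 0 < α)
    (hΩ : ∀ u, α * (u ⬝ᵥ u) ≤ p.Om.quadVal u) (v : Fin n → ℝ) :
    p.cov.quadVal v ≤ α⁻¹ * (v ⬝ᵥ v) := by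
  have h := Matrix.quadVal_inv_le_of_quadVal_le (M := (1 : Matrix (Fin n) (Fin n) ℝ))
    Matrix.PosDef.one hp (c := α⁻¹) (fun v => by
      rw [inv_mul_eq_div, le_div_iff₀' hα]
      simpa [Matrix.quadVal] using hΩ v) v
  simpa [Matrix.quadVal, cov] using h

theorem ErrBound.norm_sq_le {p : InfoPair n} {x : EuclideanSpace ℝ (Fin n)} {M α : ℝ}
    (h : p.ErrBound x.ofLp M) (hp : p.Om.PosDef) (hα : 0 < α)
    (hΩ : ∀ u, α * (u ⬝ᵥ u) ≤ p.Om.quadVal u) : ‖p.mean - x‖ ^ 2 ≤ α⁻¹ * M ^ 2 := by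
  set e := p.mean.ofLp - x.ofLp with he
  have h0 : ‖p.mean - x‖ ^ 2 = e ⬝ᵥ e := by
    rw [EuclideanSpace.norm_sq_eq]
    simp [dotProduct, he, sq]
  have h1 := h.abs_dotProduct_mean_sub_le hp e
  have h2 := quadVal_cov_le hp hα hΩ e
  have h4 := Matrix.dotProduct_self_nonneg' e
  have h5 : 0 ≤ p.cov.quadVal e := hp.inv.quadVal_nonneg e
  rw [← he, abs_of_nonneg h4] at h1
  have h6 : (e ⬝ᵥ e) ^ 2 ≤ M ^ 2 * (α⁻¹ * (e ⬝ᵥ e)) := by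
    calc (e ⬝ᵥ e) ^ 2 ≤ (M * √(p.cov.quadVal e)) ^ 2 := by gcongr
      _ = M ^ 2 * p.cov.quadVal e := by rw [mul_pow, Real.sq_sqrt h5]
      _ ≤ _ := by gcongr
  rw [h0]
  rcases h4.eq_or_lt with h7 | h7
  · rw [← h7]
    positivity
  · nlinarith

section Correct

variable {C : Matrix (Fin m) (Fin n) ℝ} {R : Matrix (Fin m) (Fin m) ℝ}

theorem quadVal_correct (p : InfoPair n) (y : EuclideanSpace ℝ (Fin m)) (u : Fin n → ℝ) :
    (p.correct C R y).Om.quadVal u = p.Om.quadVal u + R⁻¹.quadVal (C *ᵥ u) := by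
  rw [← Matrix.quadVal_transpose_mul_mul, ← Matrix.quadVal_add]
  rfl

theorem correct_posDef {p : InfoPair n} (hp : p.Om.PosDef) (hR : R.PosDef)
    (y : EuclideanSpace ℝ (Fin m)) : (p.correct C R y).Om.PosDef := by
  refine hp.add_posSemidef ?_
  simpa using hR.inv.posSemidef.conjTranspose_mul_mul_same C

/-- The vector `q - Ω x` gains only `Cᵀ R⁻¹ v`, and both `Ω(u)` and `R⁻¹(C u)` are at most the
corrected form at `u`. -/
theorem ErrBound.correct {p : InfoPair n} {x : Fin n → ℝ} {M : ℝ} (h : p.ErrBound x M)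
    (hp : p.Om.PosDef) (hR : R.PosDef) (v : EuclideanSpace ℝ (Fin m)) :
    (p.correct C R (WithLp.toLp 2 (C *ᵥ x) + v)).ErrBound x (M + √(R⁻¹.quadVal v.ofLp)) := by
  refine ⟨add_nonneg h.1 (Real.sqrt_nonneg _), fun u => ?_⟩
  have h1 : (p.correct C R (WithLp.toLp 2 (C *ᵥ x) + v)).q -
      (p.correct C R (WithLp.toLp 2 (C *ᵥ x) + v)).Om *ᵥ x =
      (p.q - p.Om *ᵥ x) + Cᵀ *ᵥ (R⁻¹ *ᵥ v.ofLp) := by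
    simp only [InfoPair.correct, WithLp.ofLp_add, Matrix.mulVec_add, Matrix.add_mulVec,
      ← Matrix.mulVec_mulVec]
    abel
  have h2 : u ⬝ᵥ Cᵀ *ᵥ (R⁻¹ *ᵥ v.ofLp) = (C *ᵥ u) ⬝ᵥ (R⁻¹ *ᵥ v.ofLp) := by
    rw [Matrix.dotProduct_mulVec, Matrix.vecMul_transpose]
  have h3 := hR.inv.posSemidef.sq_dotProduct_mulVec_le (C *ᵥ u) v.ofLp
  have h4 := hp.quadVal_nonneg u
  have h5 := hR.inv.quadVal_nonneg (C *ᵥ u)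
  have h6 := hR.inv.quadVal_nonneg v.ofLp
  rw [h1, dotProduct_add, h2, quadVal_correct, add_mul]
  refine (abs_add_le _ _).trans (add_le_add ?_ ?_)
  · refine (h.2 u).trans (mul_le_mul_of_nonneg_left (Real.sqrt_le_sqrt ?_) h.1)
    linarith
  · refine (Real.abs_le_sqrt h3).trans ?_
    rw [mul_comm, Real.sqrt_mul h6]
    gcongr
    linarith

end Correct

section Predict

variable {A Q : Matrix (Fin n) (Fin n) ℝ}

theorem predict_cov_posDef {p : InfoPair n} (hp : p.Om.PosDef) (hQ : Q.PosDef) :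
    (A * p.cov * Aᵀ + Q).PosDef := by
  refine Matrix.PosDef.posSemidef_add ?_ hQ
  simpa [cov] using hp.inv.posSemidef.mul_mul_conjTranspose_same A

theorem predict_posDef {p : InfoPair n} (hp : p.Om.PosDef) (hQ : Q.PosDef) :
    (p.predict A Q).Om.PosDef := (predict_cov_posDef hp hQ).inv

theorem quadVal_predict_cov (p : InfoPair n) (g : Fin n → ℝ) :
    (A * p.cov * Aᵀ + Q).quadVal g = p.cov.quadVal (Aᵀ *ᵥ g) + Q.quadVal g := by
  rw [Matrix.quadVal_add, Matrix.quadVal_mul_mul_transpose]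

theorem quadVal_predict_le {p : InfoPair n} (hp : p.Om.PosDef) (hQ : Q.PosDef)
    (u : Fin n → ℝ) : (p.predict A Q).Om.quadVal u ≤ Q⁻¹.quadVal u := by
  have h := Matrix.quadVal_inv_le_of_quadVal_le hQ (predict_cov_posDef (A := A) hp hQ) (c := 1)
    (fun v => by
      rw [quadVal_predict_cov, one_mul]
      have := hp.inv.quadVal_nonneg (Aᵀ *ᵥ v)
      rw [cov]
      linarith) u
  rwa [one_mul] at h

/-- Prediction keeps a fixed fraction of bounded information. For `g = A⁻ᵀ Ω u` the pairing `(A u)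
⬝ᵥ g` and `P(Aᵀ g)` both equal `Ω(u)`, while `Q(g)` is at most a constant times `Ω(u)` because `Ω ≤
b I`. Cauchy-Schwarz for the predicted covariance then gives the claim. -/
theorem exists_le_quadVal_predict (hA : IsUnit A) (hQ : Q.PosDef) {b : ℝ} (hb : 0 < b) :
    ∃ η, 0 < η ∧ ∀ p : InfoPair n, p.Om.PosDef →
      (∀ u, p.Om.quadVal u ≤ b * (u ⬝ᵥ u)) →
      ∀ u, η * p.Om.quadVal u ≤ (p.predict A Q).Om.quadVal (A *ᵥ u) := by
  have hAT : Aᵀ⁻¹ * Aᵀ = 1 := by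
    refine Matrix.nonsing_inv_mul _ ?_
    rw [Matrix.det_transpose]
    exact (Matrix.isUnit_iff_isUnit_det A).1 hA
  have hAT' : Aᵀ * Aᵀ⁻¹ = 1 := mul_eq_one_comm.1 hAT
  obtain ⟨c₁, hc₁, h₁⟩ := Matrix.exists_quadVal_le Q
  obtain ⟨c₂, hc₂, h₂⟩ := Matrix.exists_mulVec_le Aᵀ⁻¹
  have hk : 0 < 1 + c₁ * c₂ * b := by positivity
  refine ⟨(1 + c₁ * c₂ * b)⁻¹, inv_pos.2 hk, fun p hp hpb u => ?_⟩
  set g := Aᵀ⁻¹ *ᵥ (p.Om *ᵥ u) with hg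
  have hAg : Aᵀ *ᵥ g = p.Om *ᵥ u := by
    rw [hg, Matrix.mulVec_mulVec, hAT', Matrix.one_mulVec]
  have hcov : p.cov.quadVal (Aᵀ *ᵥ g) = p.Om.quadVal u := by
    rw [hAg]
    exact hp.quadVal_mulVec_inv u
  have h3 : (A *ᵥ u) ⬝ᵥ g = p.Om.quadVal u := by
    rw [dotProduct_comm, Matrix.dotProduct_mulVec, ← Matrix.mulVec_transpose, hAg,
      dotProduct_comm, Matrix.quadVal]
  have h4 : (p.Om *ᵥ u) ⬝ᵥ (p.Om *ᵥ u) ≤ b * p.Om.quadVal u := by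
    have := Matrix.quadVal_inv_le_of_quadVal_le hp (Matrix.PosDef.one) (c := b)
      (fun v => by simpa [Matrix.quadVal] using hpb v) (p.Om *ᵥ u)
    rw [hp.quadVal_mulVec_inv] at this
    simpa [Matrix.quadVal] using this
  have h5 : Q.quadVal g ≤ c₁ * c₂ * b * p.Om.quadVal u := by
    calc Q.quadVal g ≤ c₁ * (g ⬝ᵥ g) := h₁ g
      _ ≤ c₁ * (c₂ * (b * p.Om.quadVal u)) := by
        gcongr
        exact (h₂ _).trans (by gcongr)
      _ = _ := by ring
  have hP := predict_cov_posDef (A := A) hp hQ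
  have h6 := hP.inv.sq_dotProduct_le (A *ᵥ u) g
  rw [hP.inv_inv', h3, quadVal_predict_cov, hcov] at h6
  have h7 := hP.inv.quadVal_nonneg (A *ᵥ u)
  have h8 := hp.quadVal_nonneg u
  change _ ≤ (A * p.cov * Aᵀ + Q)⁻¹.quadVal (A *ᵥ u)
  rw [inv_mul_le_iff₀ hk]
  rcases h8.eq_or_lt with h9 | h9
  · rw [← h9]
    positivity
  · have h10 : p.Om.quadVal u ^ 2 ≤ (A * p.cov * Aᵀ + Q)⁻¹.quadVal (A *ᵥ u) *
        ((1 + c₁ * c₂ * b) * p.Om.quadVal u) := by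
      refine h6.trans (mul_le_mul_of_nonneg_left ?_ h7)
      linarith
    nlinarith

/-- With `g` the predicted covariance inverse applied to `u`, the error functional is `(Aᵀ g) ⬝ᵥ (x̂
- x) - g ⬝ᵥ w`, and the predicted information at `u` is `P(Aᵀ g) + Q(g)`. The old error sees only
the first summand. -/
theorem exists_errBound_predict (A : Matrix (Fin n) (Fin n) ℝ) (hQ : Q.PosDef) {α : ℝ}
    (hα : 0 < α) :
    ∃ γ c : ℝ, 0 ≤ γ ∧ γ < 1 ∧ 0 ≤ c ∧ ∀ p : InfoPair n, p.Om.PosDef →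
      (∀ u, α * (u ⬝ᵥ u) ≤ p.Om.quadVal u) → ∀ (x w : Fin n → ℝ) (M : ℝ), p.ErrBound x M →
      (p.predict A Q).ErrBound (A *ᵥ x + w) (γ * M + c * √(w ⬝ᵥ w)) := by
  obtain ⟨c₁, hc₁, h₁⟩ := hQ.exists_inv_quadVal_le
  obtain ⟨c₂, hc₂, h₂⟩ := Matrix.exists_mulVec_le Aᵀ
  -- Chosen so that `P(Aᵀ g) ≤ k Q(g)`; the first summand is then at most the fraction `k / (1 + k)`
  -- of the total.
  set k := α⁻¹ * c₂ * c₁ with hk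
  have hk0 : 0 < k := by positivity
  refine ⟨√(k / (1 + k)), √c₁, Real.sqrt_nonneg _, ?_, Real.sqrt_nonneg _, ?_⟩
  · rw [Real.sqrt_lt' one_pos, one_pow, div_lt_one (by positivity)]
    linarith
  intro p hp hpα x w M hM
  refine ⟨by have := hM.1; positivity, fun u => ?_⟩
  have hP := predict_cov_posDef (A := A) hp hQ
  set g := (A * p.cov * Aᵀ + Q)⁻¹ *ᵥ u with hg
  have hgu : (A * p.cov * Aᵀ + Q).quadVal g = (p.predict A Q).Om.quadVal u :=
    hP.quadVal_inv_mulVec u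
  have h3 : u ⬝ᵥ ((p.predict A Q).q - (p.predict A Q).Om *ᵥ (A *ᵥ x + w)) =
      (Aᵀ *ᵥ g) ⬝ᵥ (p.mean.ofLp - x) - g ⬝ᵥ w := by
    have h4 : (p.predict A Q).q - (p.predict A Q).Om *ᵥ (A *ᵥ x + w) =
        (A * p.cov * Aᵀ + Q)⁻¹ *ᵥ (A *ᵥ (p.mean.ofLp - x) - w) := by
      simp only [predict, Matrix.mulVec_sub, Matrix.mulVec_add]
      abel
    rw [h4, hP.inv.posSemidef.dotProduct_mulVec_symm, ← hg, dotProduct_comm, dotProduct_sub,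
      Matrix.dotProduct_mulVec, ← Matrix.mulVec_transpose]
  have h5 : p.cov.quadVal (Aᵀ *ᵥ g) ≤ k * Q.quadVal g := by
    calc p.cov.quadVal (Aᵀ *ᵥ g) ≤ α⁻¹ * ((Aᵀ *ᵥ g) ⬝ᵥ (Aᵀ *ᵥ g)) :=
        quadVal_cov_le hp hα hpα _
      _ ≤ α⁻¹ * (c₂ * (c₁ * Q.quadVal g)) := by
        gcongr
        exact (h₂ g).trans (by gcongr; exact h₁ g)
      _ = _ := by ring
  have h6 := hp.inv.quadVal_nonneg (Aᵀ *ᵥ g)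
  have h7 := hQ.quadVal_nonneg g
  rw [quadVal_predict_cov] at hgu
  change 0 ≤ p.cov.quadVal (Aᵀ *ᵥ g) at h6
  rw [h3, add_mul]
  refine (abs_sub _ _).trans (add_le_add ?_ ?_)
  · refine (hM.abs_dotProduct_mean_sub_le hp _).trans ?_
    rw [mul_comm (√_) M, mul_assoc, ← Real.sqrt_mul (by positivity), ← hgu]
    refine mul_le_mul_of_nonneg_left (Real.sqrt_le_sqrt ?_) hM.1
    rw [div_mul_eq_mul_div, le_div_iff₀ (by positivity)]
    linarith
  · have h8 := Matrix.PosDef.one.abs_dotProduct_le g w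
    have h9 : |g ⬝ᵥ w| ≤ √(w ⬝ᵥ w) * √(g ⬝ᵥ g) := by simpa [Matrix.quadVal] using h8
    refine h9.trans ?_
    rw [mul_comm (√c₁), mul_assoc, ← Real.sqrt_mul hc₁.le, ← hgu]
    gcongr
    refine (h₁ g).trans ?_
    gcongr
    linarith

end Predict

end InfoPair

end FilterSteps

/-! ### Event-triggered fusion: the effect of silence and of averaging. -/

noncomputable section ConsensusSteps

namespace NetState

variable {ι : Type*} {n : ℕ}

/-- All local and reference densities are nondegenerate. -/
structure Nondeg (s : NetState ι n) : Prop where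
  cur : ∀ i, (s.cur i).Om.PosDef
  ref : ∀ i, ∀ r ∈ s.ref i, r.Om.PosDef

/-- The information matrix that the out-neighbours of a node use for it is at least this fraction
of the information matrix of the node. -/
def fusionFactor (τ δ : ℝ) : ℝ := (Real.exp (1 + 2 * τ) * (1 + δ))⁻¹

theorem fusionFactor_pos {τ δ : ℝ} (hδ : 0 < 1 + δ) : 0 < fusionFactor τ δ := by
  unfold fusionFactor
  positivity

theorem fusionFactor_le_one {τ δ : ℝ} (hτ : 0 < τ) (hδ : 1 ≤ 1 + δ) : fusionFactor τ δ ≤ 1 := by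
  refine inv_le_one_of_one_le₀ (one_le_mul_of_one_le_of_one_le ?_ hδ)
  exact Real.one_le_exp (by linarith)

section Received

variable {τ δ : ℝ} {s : NetState ι n}

/-- The `getD` default in `received` is never reached, since a node without reference transmits. -/
theorem received_eq (s : NetState ι n) (j : ι) :
    s.received τ δ j = s.cur j ∨ ∃ r, s.ref j = some r ∧ s.received τ δ j = r.flatten δ ∧
      klDiv (s.cur j).law r.law ≤ ENNReal.ofReal τ := by
  unfold received
  split_ifs with h
  · exact Or.inl rfl
  · right
    unfold Transmits at h
    cases hr : s.ref j with
    | none => simp [hr] at h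
    | some r =>
      simp only [hr, not_not] at h
      exact ⟨r, rfl, rfl, h⟩

theorem received_posDef (hs : s.Nondeg) (hδ : 0 < 1 + δ) (j : ι) :
    (s.received τ δ j).Om.PosDef := by
  rcases s.received_eq (τ := τ) (δ := δ) j with h | ⟨r, hr, h, -⟩
  · rw [h]
    exact hs.cur j
  · rw [h]
    exact (hs.ref j r hr).smul (by positivity)

variable (hτ : 0 < τ) (hδ : deltaStar τ ≤ δ)
include hτ hδ

theorem one_lt_one_add_of_deltaStar_le : 1 < 1 + δ := by
  have := one_lt_one_add_deltaStar hτ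
  linarith

/-- Here `δ ≥ δ*` acts: `P ≤ (1 + δ*) P̄` inverts to `Ω̄ ≤ (1 + δ*) Ω`, and flattening divides by at
least this factor. -/
theorem quadVal_received_le (hs : s.Nondeg) (j : ι) (u : Fin n → ℝ) :
    (s.received τ δ j).Om.quadVal u ≤ (s.cur j).Om.quadVal u := by
  have h1 := one_lt_one_add_of_deltaStar_le hτ hδ
  rcases s.received_eq (τ := τ) (δ := δ) j with h | ⟨r, hr, h, hkl⟩
  · rw [h]
  · have hc := hs.cur j
    have hr' := hs.ref j r hr
    have h2 := Matrix.quadVal_inv_le_of_quadVal_le hc.inv hr'.inv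
      (quadVal_le_of_klDiv_le hc.inv hr'.inv hτ hkl) u
    rw [hc.inv_inv', hr'.inv_inv'] at h2
    rw [h, InfoPair.flatten, Matrix.quadVal_smul, one_div, inv_mul_le_iff₀ (by linarith)]
    refine h2.trans (mul_le_mul_of_nonneg_right (by linarith) (hc.quadVal_nonneg u))

theorem le_quadVal_received (hs : s.Nondeg) (j : ι) (u : Fin n → ℝ) :
    fusionFactor τ δ * (s.cur j).Om.quadVal u ≤ (s.received τ δ j).Om.quadVal u := by
  have h1 := one_lt_one_add_of_deltaStar_le hτ hδ
  have hc := hs.cur j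
  rcases s.received_eq (τ := τ) (δ := δ) j with h | ⟨r, hr, h, hkl⟩
  · rw [h]
    exact mul_le_of_le_one_left (hc.quadVal_nonneg u) (fusionFactor_le_one hτ h1.le)
  · have hr' := hs.ref j r hr
    have h2 := Matrix.quadVal_inv_le_of_quadVal_le hr'.inv hc.inv
      (quadVal_ge_of_klDiv_le hc.inv hr'.inv hτ hkl) u
    rw [hc.inv_inv', hr'.inv_inv'] at h2
    have h3 : 0 < Real.exp (1 + 2 * τ) := Real.exp_pos _
    have h4 : 0 < 1 + δ := by linarith
    rw [h, InfoPair.flatten, Matrix.quadVal_smul, fusionFactor,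
      inv_mul_le_iff₀ (by positivity), one_div]
    calc (s.cur j).Om.quadVal u ≤ Real.exp (1 + 2 * τ) * r.Om.quadVal u := h2
      _ = _ := by field_simp

/-- Replacing `P` by the reference covariance costs a factor `√(1 + δ)` on `M`. Flattening divides
the error vector by `1 + δ` but the information norm only by `√(1 + δ)`, which recovers this factor
exactly. So `M` keeps coefficient one, without which the later contraction could be lost. -/
theorem errBound_received (hs : s.Nondeg) (j : ι) {x : Fin n → ℝ} {M : ℝ}
    (hM : (s.cur j).ErrBound x M) : (s.received τ δ j).ErrBound x (M + √(2 * τ)) := by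
  have h1 := one_lt_one_add_of_deltaStar_le hτ hδ
  rcases s.received_eq (τ := τ) (δ := δ) j with h | ⟨r, hr, h, hkl⟩
  · rw [h]
    exact hM.mono (le_add_of_nonneg_right (Real.sqrt_nonneg _))
  have hc := hs.cur j
  have hr' := hs.ref j r hr
  refine ⟨add_nonneg hM.1 (Real.sqrt_nonneg _), fun u => ?_⟩
  set g := r.Om *ᵥ u with hg
  have hgu : r.cov.quadVal g = r.Om.quadVal u := hr'.quadVal_mulVec_inv u
  have h2 := abs_dotProduct_le_of_klDiv_le hc.inv hr'.inv hτ hkl g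
  have h3 := quadVal_le_of_klDiv_le hc.inv hr'.inv hτ hkl g
  change |g ⬝ᵥ ((s.cur j).mean.ofLp - r.mean.ofLp)| ≤ _ * √(r.cov.quadVal g) at h2
  change (s.cur j).cov.quadVal g ≤ _ * r.cov.quadVal g at h3
  have h4 := hM.abs_dotProduct_mean_sub_le hc g
  rw [hgu] at h2 h3
  have hnn := hr'.quadVal_nonneg u
  have hpos : 0 < 1 + δ := by linarith
  have h5 : √((s.cur j).cov.quadVal g) ≤ √(1 + δ) * √(r.Om.quadVal u) := by
    rw [← Real.sqrt_mul hpos.le]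
    refine Real.sqrt_le_sqrt (h3.trans ?_)
    gcongr
  have h6 : u ⬝ᵥ (r.q - r.Om *ᵥ x) =
      g ⬝ᵥ ((s.cur j).mean.ofLp - x) - g ⬝ᵥ ((s.cur j).mean.ofLp - r.mean.ofLp) := by
    rw [← dotProduct_sub, sub_sub_sub_cancel_left, ← InfoPair.om_mulVec_mean hr',
      ← Matrix.mulVec_sub, hr'.posSemidef.dotProduct_mulVec_symm, dotProduct_comm]
  have h7 : |u ⬝ᵥ (r.q - r.Om *ᵥ x)| ≤ (M * √(1 + δ) + √(2 * τ)) * √(r.Om.quadVal u) := by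
    rw [h6, add_mul]
    refine (abs_sub _ _).trans (add_le_add (h4.trans ?_) h2)
    rw [mul_assoc]
    exact mul_le_mul_of_nonneg_left h5 hM.1
  have h8 : u ⬝ᵥ ((r.flatten δ).q - (r.flatten δ).Om *ᵥ x) =
      (1 + δ)⁻¹ * (u ⬝ᵥ (r.q - r.Om *ᵥ x)) := by
    simp [InfoPair.flatten, Matrix.smul_mulVec, ← smul_sub]
  have h9 : (r.flatten δ).Om.quadVal u = (1 + δ)⁻¹ * r.Om.quadVal u := by
    simp [InfoPair.flatten, Matrix.quadVal_smul]
  have h10 : 1 ≤ √(1 + δ) := Real.one_le_sqrt.2 h1.le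
  have h11 : √(1 + δ) * √(1 + δ) = 1 + δ := Real.mul_self_sqrt hpos.le
  have h12 : √((1 + δ)⁻¹ * r.Om.quadVal u) = (√(1 + δ))⁻¹ * √(r.Om.quadVal u) := by
    rw [Real.sqrt_mul (by positivity), Real.sqrt_inv]
  rw [h, h8, h9, h12, abs_mul, abs_of_pos (inv_pos.2 hpos), inv_mul_le_iff₀ hpos]
  refine h7.trans (le_of_le_of_eq (b := (M + √(2 * τ)) * √(1 + δ) * √(r.Om.quadVal u)) ?_ ?_)
  · refine mul_le_mul_of_nonneg_right ?_ (Real.sqrt_nonneg _)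
    have := Real.sqrt_nonneg (2 * τ)
    nlinarith
  · field_simp
    rw [sq, h11]

end Received

section Fusion

variable {τ δ : ℝ} {s : NetState ι n}

/-- The data from node `j` that is fused by node `i`. -/
def fused (τ δ : ℝ) (s : NetState ι n) (i j : ι) : InfoPair n :=
  open scoped Classical in if j = i then s.cur j else s.received τ δ j

theorem fused_self (i : ι) : s.fused τ δ i i = s.cur i := by simp [fused]

theorem fused_eq (i j : ι) :
    s.fused τ δ i j = s.cur j ∨ s.fused τ δ i j = s.received τ δ j := by
  unfold fused
  split_ifs <;> simp

theorem fused_posDef (hs : s.Nondeg) (hδ : 0 < 1 + δ) (i j : ι) :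
    (s.fused τ δ i j).Om.PosDef := by
  rcases s.fused_eq (τ := τ) (δ := δ) i j with h | h
  · rw [h]
    exact hs.cur j
  · rw [h]
    exact received_posDef hs hδ j

section Bounds

variable (hτ : 0 < τ) (hδ : deltaStar τ ≤ δ)
include hτ hδ

theorem quadVal_fused_le (hs : s.Nondeg) (i j : ι) (u : Fin n → ℝ) :
    (s.fused τ δ i j).Om.quadVal u ≤ (s.cur j).Om.quadVal u := by
  rcases s.fused_eq (τ := τ) (δ := δ) i j with h | h
  · rw [h]
  · rw [h]
    exact quadVal_received_le hτ hδ hs j u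

theorem le_quadVal_fused (hs : s.Nondeg) (i j : ι) (u : Fin n → ℝ) :
    fusionFactor τ δ * (s.cur j).Om.quadVal u ≤ (s.fused τ δ i j).Om.quadVal u := by
  rcases s.fused_eq (τ := τ) (δ := δ) i j with h | h
  · rw [h]
    exact mul_le_of_le_one_left ((hs.cur j).quadVal_nonneg u)
      (fusionFactor_le_one hτ (one_lt_one_add_of_deltaStar_le hτ hδ).le)
  · rw [h]
    exact le_quadVal_received hτ hδ hs j u

theorem errBound_fused (hs : s.Nondeg) (i j : ι) {x : Fin n → ℝ} {M : ℝ}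
    (hM : (s.cur j).ErrBound x M) : (s.fused τ δ i j).ErrBound x (M + √(2 * τ)) := by
  rcases s.fused_eq (τ := τ) (δ := δ) i j with h | h
  · rw [h]
    exact hM.mono (le_add_of_nonneg_right (Real.sqrt_nonneg _))
  · rw [h]
    exact errBound_received hτ hδ hs j hM

end Bounds

variable [Fintype ι] {G : Digraph ι} {W : ι → ι → ℝ}

/-- The nodes whose data is fused by node `i`. -/
def sources (G : Digraph ι) (i : ι) : Finset ι :=
  open scoped Classical in insert i (inNeighbors G i)

theorem not_mem_inNeighbors (G : Digraph ι) (i : ι) : i ∉ inNeighbors G i := by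
  simp [inNeighbors]

theorem sum_sources {β : Type*} [AddCommMonoid β] (f : ι → β) (i : ι) :
    ∑ j ∈ sources G i, f j = f i + ∑ j ∈ inNeighbors G i, f j := by
  classical
  rw [sources, Finset.sum_insert (by convert not_mem_inNeighbors G i)]

theorem self_mem_sources (G : Digraph ι) (i : ι) : i ∈ sources G i := by simp [sources]

theorem mem_sources_of_adj {i j : ι} (h : G.Adj j i) : j ∈ sources G i := by
  by_cases hji : j = i <;> simp [sources, inNeighbors, h, hji]

theorem weight_pos (hW : IsConsensusWeights G W) {i j : ι} (hj : j ∈ sources G i) :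
    0 < W i j := by
  classical
  have hj' : j = i ∨ j ∈ inNeighbors G i := by simpa [sources] using hj
  rcases hj' with rfl | h
  · exact hW.self_pos _
  · exact hW.neighbor_pos i j h

theorem sum_weight (hW : IsConsensusWeights G W) (i : ι) : ∑ j ∈ sources G i, W i j = 1 := by
  rw [sum_sources, hW.sum_eq_one]

/-- Counting the node among its own sources makes the consensus step a single convex combination. -/
theorem sum_fused {β : Type*} [AddCommMonoid β] (f : ι → InfoPair n → β) (i : ι) :
    ∑ j ∈ sources G i, f j (s.fused τ δ i j) =
      f i (s.cur i) + ∑ j ∈ inNeighbors G i, f j (s.received τ δ j) := by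
  rw [sum_sources, fused_self]
  congr 1
  refine Finset.sum_congr rfl fun j hj => ?_
  have hji : j ≠ i := by
    rintro rfl
    exact not_mem_inNeighbors G j hj
  simp [fused, hji]

theorem consensusStep_q (i : ι) : ((s.consensusStep G W τ δ).cur i).q =
    ∑ j ∈ sources G i, W i j • (s.fused τ δ i j).q :=
  (sum_fused (fun j p => W i j • p.q) i).symm

theorem consensusStep_Om (i : ι) : ((s.consensusStep G W τ δ).cur i).Om =
    ∑ j ∈ sources G i, W i j • (s.fused τ δ i j).Om :=
  (sum_fused (fun j p => W i j • p.Om) i).symm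

theorem quadVal_consensusStep (i : ι) (u : Fin n → ℝ) :
    ((s.consensusStep G W τ δ).cur i).Om.quadVal u =
      ∑ j ∈ sources G i, W i j * (s.fused τ δ i j).Om.quadVal u := by
  simp [consensusStep_Om, Matrix.quadVal_sum, Matrix.quadVal_smul]

theorem Nondeg.consensusStep (hs : s.Nondeg) (hW : IsConsensusWeights G W) (hδ : 0 < 1 + δ) :
    (s.consensusStep G W τ δ).Nondeg := by
  constructor
  · intro i
    rw [consensusStep_Om]
    exact Matrix.posDef_sum ⟨i, self_mem_sources G i⟩ fun j hj =>
      (fused_posDef hs hδ i j).smul (weight_pos hW hj)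
  · intro i r hr
    simp only [NetState.consensusStep] at hr
    split_ifs at hr
    · rw [Option.mem_def, Option.some_inj] at hr
      rw [← hr]
      exact hs.cur i
    · exact hs.ref i r hr

variable (hτ : 0 < τ) (hδ : deltaStar τ ≤ δ) (hW : IsConsensusWeights G W)
include hτ hδ hW

theorem quadVal_consensusStep_le (hs : s.Nondeg) {u : Fin n → ℝ} {b : ℝ}
    (hb : ∀ j, (s.cur j).Om.quadVal u ≤ b) (i : ι) :
    ((s.consensusStep G W τ δ).cur i).Om.quadVal u ≤ b := by
  rw [quadVal_consensusStep, ← one_mul b, ← sum_weight hW i, Finset.sum_mul]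
  exact Finset.sum_le_sum fun j hj => mul_le_mul_of_nonneg_left
    ((quadVal_fused_le hτ hδ hs i j u).trans (hb j)) (weight_pos hW hj).le

theorem le_quadVal_consensusStep (hs : s.Nondeg) {i j : ι} (hj : j ∈ sources G i)
    (u : Fin n → ℝ) : W i j * fusionFactor τ δ * (s.cur j).Om.quadVal u ≤
      ((s.consensusStep G W τ δ).cur i).Om.quadVal u := by
  have hpos : 0 < 1 + δ := by linarith [one_lt_one_add_of_deltaStar_le hτ hδ]
  rw [quadVal_consensusStep, mul_assoc]
  refine (mul_le_mul_of_nonneg_left (le_quadVal_fused hτ hδ hs i j u)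
    (weight_pos hW hj).le).trans ?_
  exact Finset.single_le_sum (f := fun j => W i j * (s.fused τ δ i j).Om.quadVal u)
    (fun k hk => mul_nonneg (weight_pos hW hk).le ((fused_posDef hs hpos i k).quadVal_nonneg u)) hj

theorem errBound_consensusStep (hs : s.Nondeg) {x : Fin n → ℝ} {M : ℝ}
    (hM : ∀ j, (s.cur j).ErrBound x M) (i : ι) :
    ((s.consensusStep G W τ δ).cur i).ErrBound x (M + √(2 * τ)) := by
  have hpos : 0 < 1 + δ := by linarith [one_lt_one_add_of_deltaStar_le hτ hδ]
  have hf := fun j => errBound_fused hτ hδ hs i j (hM j)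
  refine ⟨(hf i).1, fun u => ?_⟩
  have h1 : ((s.consensusStep G W τ δ).cur i).q - ((s.consensusStep G W τ δ).cur i).Om *ᵥ x =
      ∑ j ∈ sources G i, W i j • ((s.fused τ δ i j).q - (s.fused τ δ i j).Om *ᵥ x) := by
    simp [consensusStep_Om, consensusStep_q, Matrix.sum_mulVec, Matrix.smul_mulVec, smul_sub]
  rw [h1, dotProduct_sum, quadVal_consensusStep]
  refine (Finset.abs_sum_le_sum_abs _ _).trans ?_
  -- Jensen's inequality for the square root: averaging does not enlarge the weighted error.
  have h2 : ∑ j ∈ sources G i, W i j * √((s.fused τ δ i j).Om.quadVal u) ≤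
      √(∑ j ∈ sources G i, W i j * (s.fused τ δ i j).Om.quadVal u) :=
    Real.strictConcaveOn_sqrt.concaveOn.le_map_sum (fun j hj => (weight_pos hW hj).le)
      (sum_weight hW i) (fun j _ => (fused_posDef hs hpos i j).quadVal_nonneg u)
  refine le_trans ?_ (mul_le_mul_of_nonneg_left h2 (hf i).1)
  rw [Finset.mul_sum]
  refine Finset.sum_le_sum fun j hj => ?_
  have hw := weight_pos hW hj
  rw [dotProduct_smul, smul_eq_mul, abs_mul, abs_of_pos hw, mul_left_comm]
  exact mul_le_mul_of_nonneg_left ((hf j).2 u) hw.le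

section Iterate

theorem Nondeg.iterate_consensusStep (hs : s.Nondeg) (l : ℕ) :
    ((NetState.consensusStep G W τ δ)^[l] s).Nondeg := by
  induction l with
  | zero => exact hs
  | succ l ih =>
    rw [Function.iterate_succ_apply']
    exact ih.consensusStep hW (by linarith [one_lt_one_add_of_deltaStar_le hτ hδ])

theorem quadVal_iterate_consensusStep_le (hs : s.Nondeg) {u : Fin n → ℝ} {b : ℝ}
    (hb : ∀ j, (s.cur j).Om.quadVal u ≤ b) (l : ℕ) (i : ι) :
    (((NetState.consensusStep G W τ δ)^[l] s).cur i).Om.quadVal u ≤ b := by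
  induction l generalizing i with
  | zero => exact hb i
  | succ l ih =>
    rw [Function.iterate_succ_apply']
    exact quadVal_consensusStep_le hτ hδ hW (hs.iterate_consensusStep hτ hδ hW l) ih i

theorem errBound_iterate_consensusStep (hs : s.Nondeg) {x : Fin n → ℝ} {M : ℝ}
    (hM : ∀ j, (s.cur j).ErrBound x M) (l : ℕ) (i : ι) :
    (((NetState.consensusStep G W τ δ)^[l] s).cur i).ErrBound x (M + l * √(2 * τ)) := by
  induction l generalizing i with
  | zero => simpa using hM i
  | succ l ih =>
    rw [Function.iterate_succ_apply']
    convert errBound_consensusStep hτ hδ hW (hs.iterate_consensusStep hτ hδ hW l) ih i using 1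
    push_cast
    ring

theorem le_quadVal_iterate_consensusStep_self {ε : ℝ} (hε : 0 ≤ ε)
    (h : ∀ i, ε ≤ W i i * fusionFactor τ δ) (hs : s.Nondeg) (l : ℕ) (i : ι) (u : Fin n → ℝ) :
    ε ^ l * (s.cur i).Om.quadVal u ≤
      (((NetState.consensusStep G W τ δ)^[l] s).cur i).Om.quadVal u := by
  induction l with
  | zero => simp
  | succ l ih =>
    have hl := hs.iterate_consensusStep hτ hδ hW l
    rw [Function.iterate_succ_apply', pow_succ', mul_assoc]
    refine le_trans ?_ (le_quadVal_consensusStep hτ hδ hW hl (self_mem_sources G i) u)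
    have h0 := (hl.cur i).quadVal_nonneg u
    exact mul_le_mul (h i) ih (mul_nonneg (by positivity) ((hs.cur i).quadVal_nonneg u))
      (hε.trans (h i))

/-- The first step carries the information over the arc; the other `l - 1` steps retain it through
the self weights. -/
theorem exists_le_quadVal_iterate_consensusStep {l : ℕ} (hl : 1 ≤ l) :
    ∃ ε, 0 < ε ∧ ∀ s : NetState ι n, s.Nondeg → ∀ i, ∀ j ∈ sources G i, ∀ u,
      ε * (s.cur j).Om.quadVal u ≤
        (((NetState.consensusStep G W τ δ)^[l] s).cur i).Om.quadVal u := by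
  have hpos : 0 < 1 + δ := by linarith [one_lt_one_add_of_deltaStar_le hτ hδ]
  have hκ := fusionFactor_pos (τ := τ) hpos
  obtain ⟨ε, hε, h⟩ := exists_pos_forall_le
    (fun a : {a : ι × ι // a.2 ∈ sources G a.1} => W a.1.1 a.1.2 * fusionFactor τ δ)
    (fun a => mul_pos (weight_pos hW a.2) hκ)
  obtain ⟨l, rfl⟩ := Nat.exists_eq_add_of_le' hl
  refine ⟨ε ^ (l + 1), by positivity, fun s hs i j hj u => ?_⟩
  rw [Function.iterate_succ_apply, pow_succ, mul_assoc]
  have h1 := hs.consensusStep hW (τ := τ) hpos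
  refine le_trans (mul_le_mul_of_nonneg_left ?_ (by positivity))
    (le_quadVal_iterate_consensusStep_self hτ hδ hW hε.le
      (fun i => h ⟨(i, i), self_mem_sources G i⟩) h1 l i u)
  refine le_trans ?_ (le_quadVal_consensusStep hτ hδ hW hs hj u)
  exact mul_le_mul_of_nonneg_right (h ⟨(i, j), hj⟩) ((hs.cur j).quadVal_nonneg u)

theorem exists_le_quadVal_iterate_consensusStep_self (l : ℕ) :
    ∃ ε, 0 < ε ∧ ∀ s : NetState ι n, s.Nondeg → ∀ i u,
      ε * (s.cur i).Om.quadVal u ≤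
        (((NetState.consensusStep G W τ δ)^[l] s).cur i).Om.quadVal u := by
  rcases Nat.eq_zero_or_pos l with rfl | hl
  · exact ⟨1, one_pos, fun s _ i u => by simp⟩
  · obtain ⟨ε, hε, h⟩ := exists_le_quadVal_iterate_consensusStep (n := n) hτ hδ hW hl
    exact ⟨ε, hε, fun s hs i u => h s hs i i (self_mem_sources G i) u⟩

end Iterate

end Fusion

end NetState

end ConsensusSteps

/-! ### Bounds on the information matrices, uniform in time and in the data. -/

noncomputable section UniformBounds

theorem exists_pos_forall_ge {α : Type*} [Finite α] (f : α → ℝ) :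
    ∃ b, 0 < b ∧ ∀ a, f a ≤ b := by
  obtain ⟨b, hb⟩ := Set.finite_range f |>.bddAbove
  exact ⟨max b 1, by positivity, fun a => (hb ⟨a, rfl⟩).trans (le_max_left _ _)⟩

theorem Matrix.mulVec_eq_zero_of_rank_eq {r : Type*} [Fintype r] {n : ℕ}
    {O : Matrix r (Fin n) ℝ} (hO : O.rank = n) {u : Fin n → ℝ} (hu : O *ᵥ u = 0) : u = 0 := by
  have h1 := O.mulVecLin.finrank_range_add_finrank_ker
  rw [Matrix.rank] at hO
  rw [hO, Module.finrank_fin_fun] at h1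
  have h2 : LinearMap.ker O.mulVecLin = ⊥ := Submodule.finrank_eq_zero.1 (by omega)
  exact (LinearMap.ker_eq_bot'.1 h2) u hu

theorem eq_zero_of_isObservable {ι : Type*} {n : ℕ} {m : ι → ℕ} {S : Finset ι}
    {A : Matrix (Fin n) (Fin n) ℝ} {C : (i : ι) → Matrix (Fin (m i)) (Fin n) ℝ}
    (hobs : IsObservable A (stackedOutput S C)) {u : Fin n → ℝ}
    (hu : ∀ s : Fin n, ∀ i ∈ S, C i *ᵥ (A ^ (s : ℕ) *ᵥ u) = 0) : u = 0 := by
  refine Matrix.mulVec_eq_zero_of_rank_eq hobs ?_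
  ext ⟨s, ⟨i, hi⟩, c⟩
  have h := congrFun (hu s i hi) c
  rw [Matrix.mulVec_mulVec] at h
  exact h

namespace ETFilter

open NetState

variable {ι : Type*} [Fintype ι] {n : ℕ} {m : ι → ℕ}

/-- The standing assumptions on the noise covariances, the weights, the parameters and the
initialization of the filter. -/
structure Admissible (F : ETFilter ι n m) : Prop where
  posDef_Q : F.Q.PosDef
  posDef_R : ∀ i ∈ F.S, (F.R i).PosDef
  weights : IsConsensusWeights F.G F.W
  tau_pos : 0 < F.τ
  delta_ge : deltaStar F.τ ≤ F.δ
  nondeg_init : F.init.Nondeg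

/-- The network data after the consensus steps at time `k`. -/
def consensus (F : ETFilter ι n m) (y : ℕ → (i : ι) → EuclideanSpace ℝ (Fin (m i))) (k : ℕ) :
    NetState ι n :=
  (NetState.consensusStep F.G F.W F.τ F.δ)^[F.L] (F.posterior y k)

variable {F : ETFilter ι n m}

theorem quadVal_posterior (y : ℕ → (i : ι) → EuclideanSpace ℝ (Fin (m i))) (k : ℕ) (i : ι)
    (u : Fin n → ℝ) : ((F.posterior y k).cur i).Om.quadVal u =
      ((F.prior y k).cur i).Om.quadVal u +
        open scoped Classical in if i ∈ F.S then (F.R i)⁻¹.quadVal (F.C i *ᵥ u) else 0 := by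
  classical
  by_cases hi : i ∈ F.S
  · simp [posterior, correctStep, hi, InfoPair.quadVal_correct]
  · simp [posterior, correctStep, hi]

theorem prior_succ_cur (y : ℕ → (i : ι) → EuclideanSpace ℝ (Fin (m i))) (k : ℕ) (i : ι) :
    (F.prior y (k + 1)).cur i = ((F.consensus y k).cur i).predict F.A F.Q := rfl

section Propagation

variable {ε : ℝ} (hε : 0 < ε)
  (h : ∀ y k i, ∀ j ∈ sources F.G i, ∀ u, ε * ((F.posterior y k).cur j).Om.quadVal u ≤
    ((F.posterior y (k + 1)).cur i).Om.quadVal (F.A *ᵥ u))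
include hε h

theorem le_quadVal_posterior_add_succ {N : ℕ} {j a b : ι} (hab : a ∈ sources F.G b)
    (hN : ∀ y k u, ε ^ N * ((F.posterior y k).cur j).Om.quadVal u ≤
      ((F.posterior y (k + N)).cur a).Om.quadVal (F.A ^ N *ᵥ u))
    (y : ℕ → (i : ι) → EuclideanSpace ℝ (Fin (m i))) (k : ℕ) (u : Fin n → ℝ) :
    ε ^ (N + 1) * ((F.posterior y k).cur j).Om.quadVal u ≤
      ((F.posterior y (k + (N + 1))).cur b).Om.quadVal (F.A ^ (N + 1) *ᵥ u) := by
  have h1 := h y (k + N) b a hab (F.A ^ N *ᵥ u)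
  rw [Matrix.mulVec_mulVec, ← pow_succ'] at h1
  refine le_trans ?_ h1
  rw [pow_succ', mul_assoc]
  exact mul_le_mul_of_nonneg_left (hN y k u) hε.le

theorem le_quadVal_posterior_add_self (j : ι) (N : ℕ)
    (y : ℕ → (i : ι) → EuclideanSpace ℝ (Fin (m i))) (k : ℕ) (u : Fin n → ℝ) :
    ε ^ N * ((F.posterior y k).cur j).Om.quadVal u ≤
      ((F.posterior y (k + N)).cur j).Om.quadVal (F.A ^ N *ᵥ u) := by
  induction N generalizing y k u with
  | zero => simp
  | succ N ih => exact le_quadVal_posterior_add_succ hε h (self_mem_sources F.G j) ih y k u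

/-- Information advances by one arc per time step. Any time beyond the path length is spent waiting
at `j`, so every `N ≥ d` works. -/
theorem exists_le_quadVal_posterior_add {i j : ι} (hij : Relation.ReflTransGen F.G.Adj j i) :
    ∃ d : ℕ, ∀ N, d ≤ N → ∀ y k u, ε ^ N * ((F.posterior y k).cur j).Om.quadVal u ≤
      ((F.posterior y (k + N)).cur i).Om.quadVal (F.A ^ N *ᵥ u) := by
  induction hij with
  | refl => exact ⟨0, fun N _ => le_quadVal_posterior_add_self hε h j N⟩
  | tail _ hadj ih =>
    obtain ⟨d, hd⟩ := ih
    refine ⟨d + 1, fun N hN => ?_⟩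
    obtain ⟨N, rfl⟩ := Nat.exists_eq_add_of_le' (Nat.one_le_of_lt hN)
    exact le_quadVal_posterior_add_succ hε h (mem_sources_of_adj hadj) (hd N (by omega))

end Propagation

namespace Admissible

variable (hF : F.Admissible) (y : ℕ → (i : ι) → EuclideanSpace ℝ (Fin (m i)))
include hF

theorem quadVal_correction_nonneg (i : ι) (u : Fin n → ℝ) :
    0 ≤ open scoped Classical in if i ∈ F.S then (F.R i)⁻¹.quadVal (F.C i *ᵥ u) else 0 := by
  classical
  split_ifs with hi
  · exact (hF.posDef_R i hi).inv.quadVal_nonneg _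
  · exact le_rfl

theorem quadVal_prior_le_posterior (k : ℕ) (i : ι) (u : Fin n → ℝ) :
    ((F.prior y k).cur i).Om.quadVal u ≤ ((F.posterior y k).cur i).Om.quadVal u := by
  rw [quadVal_posterior]
  exact le_add_of_nonneg_right (hF.quadVal_correction_nonneg i u)

theorem nondeg_correctStep {s : NetState ι n} (hs : s.Nondeg)
    (z : (i : ι) → EuclideanSpace ℝ (Fin (m i))) : (s.correctStep F.S F.C F.R z).Nondeg := by
  refine ⟨fun i => ?_, hs.ref⟩
  simp only [correctStep]
  split_ifs with hi
  · exact InfoPair.correct_posDef (hs.cur i) (hF.posDef_R i hi) _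
  · exact hs.cur i

theorem nondeg_predictStep {s : NetState ι n} (hs : s.Nondeg) :
    (s.predictStep F.A F.Q).Nondeg := by
  refine ⟨fun i => InfoPair.predict_posDef (hs.cur i) hF.posDef_Q, fun i r hr => ?_⟩
  obtain ⟨r', hr', rfl⟩ := Option.map_eq_some_iff.1 hr
  exact InfoPair.predict_posDef (hs.ref i r' hr') hF.posDef_Q

theorem nondeg_iterate {s : NetState ι n} (hs : s.Nondeg) (l : ℕ) :
    ((NetState.consensusStep F.G F.W F.τ F.δ)^[l] s).Nondeg :=
  hs.iterate_consensusStep hF.tau_pos hF.delta_ge hF.weights l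

theorem nondeg_prior (k : ℕ) : (F.prior y k).Nondeg := by
  induction k with
  | zero => exact hF.nondeg_init
  | succ k ih => exact hF.nondeg_predictStep (hF.nondeg_iterate (hF.nondeg_correctStep ih _) _)

theorem nondeg_posterior (k : ℕ) : (F.posterior y k).Nondeg :=
  hF.nondeg_correctStep (hF.nondeg_prior y k) _

theorem nondeg_consensus (k : ℕ) : (F.consensus y k).Nondeg :=
  hF.nondeg_iterate (hF.nondeg_posterior y k) _

/-- Every prediction resets the information to at most `Q⁻¹`, whatever came before; only the initial
prior needs separate treatment. -/
theorem exists_quadVal_posterior_le : ∃ b, 0 < b ∧ ∀ y k i u,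
    ((F.posterior y k).cur i).Om.quadVal u ≤ b * (u ⬝ᵥ u) := by
  classical
  choose b₁ hb₁ h₁ using fun i => Matrix.exists_quadVal_le (F.init.cur i).Om
  obtain ⟨b₂, hb₂, h₂⟩ := Matrix.exists_quadVal_le F.Q⁻¹
  choose b₃ hb₃ h₃ using fun i => Matrix.exists_quadVal_le ((F.C i)ᵀ * (F.R i)⁻¹ * F.C i)
  obtain ⟨b, hb, h⟩ := exists_pos_forall_ge fun i => b₁ i + b₂ + b₃ i
  refine ⟨b, hb, fun y k i u => ?_⟩
  have hu := Matrix.dotProduct_self_nonneg' u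
  have hprior : ((F.prior y k).cur i).Om.quadVal u ≤ (b₁ i + b₂) * (u ⬝ᵥ u) := by
    cases k with
    | zero =>
      refine (h₁ i u).trans ?_
      gcongr
      linarith
    | succ k =>
      rw [prior_succ_cur]
      refine (InfoPair.quadVal_predict_le ((hF.nondeg_consensus y k).cur i) hF.posDef_Q u).trans
        ((h₂ u).trans ?_)
      gcongr
      linarith [hb₁ i]
  have hcorr : (if i ∈ F.S then (F.R i)⁻¹.quadVal (F.C i *ᵥ u) else 0) ≤ b₃ i * (u ⬝ᵥ u) := by
    split_ifs
    · rw [← Matrix.quadVal_transpose_mul_mul]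
      exact h₃ i u
    · exact mul_nonneg (hb₃ i).le hu
  rw [quadVal_posterior]
  refine (add_le_add hprior hcorr).trans ?_
  rw [← add_mul]
  exact mul_le_mul_of_nonneg_right (h i) hu

theorem exists_le_quadVal_posterior_succ (hA : IsUnit F.A) (hL : 1 ≤ F.L) :
    ∃ ε, 0 < ε ∧ ε ≤ 1 ∧ ∀ y k i, ∀ j ∈ sources F.G i, ∀ u,
      ε * ((F.posterior y k).cur j).Om.quadVal u ≤
        ((F.posterior y (k + 1)).cur i).Om.quadVal (F.A *ᵥ u) := by
  obtain ⟨b, hb, hbound⟩ := hF.exists_quadVal_posterior_le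
  obtain ⟨ε, hε, h₁⟩ := exists_le_quadVal_iterate_consensusStep (n := n) hF.tau_pos hF.delta_ge
    hF.weights hL
  obtain ⟨η, hη, h₂⟩ := InfoPair.exists_le_quadVal_predict hA hF.posDef_Q hb
  -- The cap at one makes powers of the constant decrease, so that different delays share one
  -- exponent later.
  refine ⟨min 1 (η * ε), by positivity, min_le_left _ _, fun y k i j hj u => ?_⟩
  have hs := hF.nondeg_posterior y k
  refine le_trans ?_ (hF.quadVal_prior_le_posterior y (k + 1) i _)
  rw [prior_succ_cur]
  refine le_trans ?_ (h₂ _ ((hF.nondeg_consensus y k).cur i) (fun v => ?_) u)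
  · refine (mul_le_mul_of_nonneg_right (min_le_right _ _) ((hs.cur j).quadVal_nonneg u)).trans ?_
    rw [mul_assoc]
    exact mul_le_mul_of_nonneg_left (h₁ _ hs i j hj u) hη.le
  · exact quadVal_iterate_consensusStep_le hF.tau_pos hF.delta_ge hF.weights hs
      (fun j => hbound y k j v) _ i

/-- The sum is the quadratic form of the `R⁻¹`-weighted observability Gramian; if it vanishes, so do
all outputs `C_j A^s u`. -/
theorem exists_le_sum_output (hobs : IsObservable F.A (stackedOutput F.S F.C)) :
    ∃ c, 0 < c ∧ ∀ u : Fin n → ℝ, c * (u ⬝ᵥ u) ≤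
      ∑ s : Fin n, ∑ j ∈ F.S, (F.R j)⁻¹.quadVal (F.C j *ᵥ (F.A ^ (s : ℕ) *ᵥ u)) := by
  set W : Matrix (Fin n) (Fin n) ℝ := ∑ s : Fin n, ∑ j ∈ F.S,
    (F.C j * F.A ^ (s : ℕ))ᵀ * (F.R j)⁻¹ * (F.C j * F.A ^ (s : ℕ)) with hWdef
  have hWq : ∀ u, W.quadVal u =
      ∑ s : Fin n, ∑ j ∈ F.S, (F.R j)⁻¹.quadVal (F.C j *ᵥ (F.A ^ (s : ℕ) *ᵥ u)) := fun u => by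
    simp only [hWdef, Matrix.quadVal_sum, Matrix.quadVal_transpose_mul_mul, Matrix.mulVec_mulVec]
  have hnn : ∀ (u : Fin n → ℝ) (s : Fin n), ∀ j ∈ F.S,
      0 ≤ (F.R j)⁻¹.quadVal (F.C j *ᵥ (F.A ^ (s : ℕ) *ᵥ u)) := fun u s j hj =>
    (hF.posDef_R j hj).inv.quadVal_nonneg _
  have hWsemi : W.PosSemidef := Matrix.posSemidef_sum _ fun s _ =>
    Matrix.posSemidef_sum _ fun j hj => by
      simpa using (hF.posDef_R j hj).inv.posSemidef.conjTranspose_mul_mul_same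
        (F.C j * F.A ^ (s : ℕ))
  have hW : W.PosDef := by
    refine Matrix.PosDef.of_dotProduct_mulVec_pos hWsemi.isHermitian fun u hu => ?_
    have h0 := hWsemi.quadVal_nonneg u
    rw [star_trivial]
    refine lt_of_le_of_ne h0 fun h => hu (eq_zero_of_isObservable hobs fun s j hj => ?_)
    change 0 = W.quadVal u at h
    rw [hWq, eq_comm, Finset.sum_eq_zero_iff_of_nonneg
      (fun s _ => Finset.sum_nonneg fun j hj => hnn u s j hj)] at h
    have h1 := (Finset.sum_eq_zero_iff_of_nonneg (hnn u s)).1 (h s (Finset.mem_univ s)) j hj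
    by_contra hne
    exact ((hF.posDef_R j hj).inv.quadVal_pos hne).ne' h1
  obtain ⟨c, hc, h⟩ := hW.exists_le_quadVal
  exact ⟨c, hc, fun u => hWq u ▸ h u⟩

/-- Write `u = A^N t`. The measurement of sensor `j` at time `k - (N - s)` contributes `R_j⁻¹(C_j
A^s t)`, of which a fraction of at least `ε^N` has reached node `i` by time `k`. Over `s < n` and `j
∈ S` these terms add up to the Gramian at `t`. For the finitely many `k < N`, the initial
information retained by the node itself suffices. -/
theorem exists_le_quadVal_posterior (hA : IsUnit F.A) (hL : 1 ≤ F.L)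
    (hobs : IsObservable F.A (stackedOutput F.S F.C)) (hconn : StronglyConnected F.G) :
    ∃ α, 0 < α ∧ ∀ y k i u, α * (u ⬝ᵥ u) ≤ ((F.posterior y k).cur i).Om.quadVal u := by
  classical
  obtain ⟨ε, hε, hε1, hstep⟩ := hF.exists_le_quadVal_posterior_succ hA hL
  suffices H : ∀ i, ∃ α, 0 < α ∧ ∀ y k u,
      α * (u ⬝ᵥ u) ≤ ((F.posterior y k).cur i).Om.quadVal u by
    choose α hα h using H
    obtain ⟨a, ha, h'⟩ := exists_pos_forall_le α hα
    exact ⟨a, ha, fun y k i u => (mul_le_mul_of_nonneg_right (h' i)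
      (Matrix.dotProduct_self_nonneg' u)).trans (h i y k u)⟩
  intro i
  have hApow : ∀ (k : ℕ) (u : Fin n → ℝ), ∃ t, u = F.A ^ k *ᵥ t := fun k u =>
    ⟨(F.A ^ k)⁻¹ *ᵥ u, by
      rw [Matrix.mulVec_mulVec, Matrix.mul_nonsing_inv _
        ((Matrix.isUnit_iff_isUnit_det _).1 (hA.pow k)), Matrix.one_mulVec]⟩
  choose d hd using fun j => exists_le_quadVal_posterior_add hε hstep (hconn j i)
  have hearly : ∀ k : ℕ, ∃ α, 0 < α ∧ ∀ y u,
      α * (u ⬝ᵥ u) ≤ ((F.posterior y k).cur i).Om.quadVal u := by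
    intro k
    obtain ⟨c₀, hc₀, h₀⟩ := (hF.nondeg_init.cur i).exists_le_quadVal
    obtain ⟨c₁, hc₁, h₁⟩ := Matrix.exists_mulVec_le (F.A ^ k)
    refine ⟨ε ^ k * c₀ / c₁, by positivity, fun y u => ?_⟩
    obtain ⟨t, rfl⟩ := hApow k u
    have h2 := (h₀ t).trans (hF.quadVal_prior_le_posterior y 0 i t)
    calc ε ^ k * c₀ / c₁ * ((F.A ^ k *ᵥ t) ⬝ᵥ (F.A ^ k *ᵥ t))
        ≤ ε ^ k * c₀ / c₁ * (c₁ * (t ⬝ᵥ t)) := by gcongr; exact h₁ t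
      _ = ε ^ k * (c₀ * (t ⬝ᵥ t)) := by field_simp
      _ ≤ ε ^ k * ((F.posterior y 0).cur i).Om.quadVal t := by gcongr
      _ ≤ _ := by simpa using le_quadVal_posterior_add_self hε hstep i k y 0 t
  -- This leaves a travel time `N - s ≥ d j` for all `s < n` and all `j`.
  set N := ∑ j, d j + n with hN
  have hlate : ∃ α, 0 < α ∧ ∀ y k u, N ≤ k →
      α * (u ⬝ᵥ u) ≤ ((F.posterior y k).cur i).Om.quadVal u := by
    obtain ⟨c₀, hc₀, h₀⟩ := hF.exists_le_sum_output hobs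
    obtain ⟨c₁, hc₁, h₁⟩ := Matrix.exists_mulVec_le (F.A ^ N)
    -- At most `n * F.S.card` terms are each bounded by the form at node `i`; the `+ 1` keeps the
    -- denominator positive if there are none.
    refine ⟨ε ^ N * c₀ / (c₁ * (n * F.S.card + 1)), by positivity, fun y k u hk => ?_⟩
    obtain ⟨t, rfl⟩ := hApow N u
    set Y := ((F.posterior y k).cur i).Om.quadVal (F.A ^ N *ᵥ t) with hY
    have hY0 : 0 ≤ Y := ((hF.nondeg_posterior y k).cur i).quadVal_nonneg _
    have hterm : ∀ s : Fin n, ∀ j ∈ F.S,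
        ε ^ N * (F.R j)⁻¹.quadVal (F.C j *ᵥ (F.A ^ (s : ℕ) *ᵥ t)) ≤ Y := by
      intro s j hj
      have hs := s.2
      have hdj : d j ≤ ∑ j, d j := Finset.single_le_sum (fun _ _ => Nat.zero_le _)
        (Finset.mem_univ j)
      have h2 := hd j (N - s) (by omega) y (k - (N - s)) (F.A ^ (s : ℕ) *ᵥ t)
      rw [Matrix.mulVec_mulVec, ← pow_add, Nat.sub_add_cancel (by omega),
        Nat.sub_add_cancel (by omega)] at h2
      refine le_trans ?_ h2
      have h3 := (hF.posDef_R j hj).inv.quadVal_nonneg (F.C j *ᵥ (F.A ^ (s : ℕ) *ᵥ t))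
      refine mul_le_mul (pow_le_pow_of_le_one hε.le hε1 (Nat.sub_le _ _)) ?_ h3 (by positivity)
      rw [quadVal_posterior, if_pos hj]
      exact le_add_of_nonneg_left (((hF.nondeg_prior y _).cur j).quadVal_nonneg _)
    have hsum : ε ^ N * (c₀ * (t ⬝ᵥ t)) ≤ (n * F.S.card + 1) * Y := by
      refine (mul_le_mul_of_nonneg_left (h₀ t) (by positivity)).trans ?_
      rw [Finset.mul_sum]
      have h2 : ∀ s : Fin n, ε ^ N * ∑ j ∈ F.S,
          (F.R j)⁻¹.quadVal (F.C j *ᵥ (F.A ^ (s : ℕ) *ᵥ t)) ≤ F.S.card * Y := fun s => by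
        rw [Finset.mul_sum, ← nsmul_eq_mul]
        exact Finset.sum_le_card_nsmul _ _ _ (hterm s)
      refine (Finset.sum_le_sum fun s _ => h2 s).trans ?_
      simp only [Finset.sum_const, Finset.card_univ, Fintype.card_fin, nsmul_eq_mul]
      linarith
    calc ε ^ N * c₀ / (c₁ * (n * F.S.card + 1)) * ((F.A ^ N *ᵥ t) ⬝ᵥ (F.A ^ N *ᵥ t))
        ≤ ε ^ N * c₀ / (c₁ * (n * F.S.card + 1)) * (c₁ * (t ⬝ᵥ t)) := by gcongr; exact h₁ t
      _ = ε ^ N * (c₀ * (t ⬝ᵥ t)) / (n * F.S.card + 1) := by field_simp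
      _ ≤ Y := by rwa [div_le_iff₀' (by positivity)]
  obtain ⟨a, ha, hlate⟩ := hlate
  choose b hb hearly using hearly
  obtain ⟨c, hc, hcb⟩ := exists_pos_forall_le (fun k : Fin N => b k) (fun k => hb k)
  refine ⟨min a c, by positivity, fun y k u => ?_⟩
  have hu := Matrix.dotProduct_self_nonneg' u
  rcases le_or_gt N k with hk | hk
  · exact (mul_le_mul_of_nonneg_right (min_le_left _ _) hu).trans (hlate y k u hk)
  · exact (mul_le_mul_of_nonneg_right ((min_le_right _ _).trans (hcb ⟨k, hk⟩)) hu).trans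
      (hearly k y u)

end Admissible

end ETFilter

end UniformBounds

/-! ### The scalar error recursion and its second moments. -/

noncomputable section MeanSquare

section Moments

variable {Ω : Type*} [MeasurableSpace Ω] {μ : Measure Ω}

theorem memLp_of_hasLaw_gaussian {n : ℕ} {X : Ω → EuclideanSpace ℝ (Fin n)}
    {c : EuclideanSpace ℝ (Fin n)} {P : Matrix (Fin n) (Fin n) ℝ}
    (hX : HasLaw X (multivariateGaussian c P) μ) : MemLp X 2 μ := by
  have h : MemLp id 2 (μ.map X) := by
    rw [hX.map_eq]
    exact IsGaussian.memLp_two_id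
  exact (memLp_map_measure_iff h.1 hX.aemeasurable).1 h

theorem integral_norm_sq_of_hasLaw_gaussian {n : ℕ} {X : Ω → EuclideanSpace ℝ (Fin n)}
    {c : EuclideanSpace ℝ (Fin n)} {P : Matrix (Fin n) (Fin n) ℝ}
    (hX : HasLaw X (multivariateGaussian c P) μ) :
    ∫ ω, ‖X ω‖ ^ 2 ∂μ = ∫ z, ‖z‖ ^ 2 ∂multivariateGaussian c P :=
  hX.integral_comp (f := fun z => ‖z‖ ^ 2) (by fun_prop)

theorem memLp_recursion {γ : ℝ} {f b : ℕ → Ω → ℝ}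
    (hf : ∀ k, f (k + 1) = fun ω => γ * f k ω + b k ω)
    (h0 : MemLp (f 0) 2 μ) (hb : ∀ k, MemLp (b k) 2 μ) (k : ℕ) : MemLp (f k) 2 μ := by
  induction k with
  | zero => exact h0
  | succ k ih =>
    rw [hf]
    exact (ih.const_mul γ).add (hb k)

/-- A contractive recursion driven by inputs with bounded second moments has bounded second
moments. -/
theorem exists_integral_sq_le_of_recursion {γ : ℝ} (hγ0 : 0 ≤ γ) (hγ1 : γ < 1)
    {f b : ℕ → Ω → ℝ} (hf : ∀ k, f (k + 1) = fun ω => γ * f k ω + b k ω)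
    (h0 : MemLp (f 0) 2 μ) (hb : ∀ k, MemLp (b k) 2 μ) {K : ℝ}
    (hK : ∀ k, ∫ ω, b k ω ^ 2 ∂μ ≤ K) : ∃ B, ∀ k, ∫ ω, f k ω ^ 2 ∂μ ≤ B := by
  have hmem := memLp_recursion hf h0 hb
  have hg : 0 < 1 - γ := by linarith
  -- The second entry is the fixed point of `B ↦ γ B + K / (1 - γ)`.
  refine ⟨max (∫ ω, f 0 ω ^ 2 ∂μ) (K / (1 - γ) ^ 2), fun k => ?_⟩
  induction k with
  | zero => exact le_max_left _ _
  | succ k ih =>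
    set B := max (∫ ω, f 0 ω ^ 2 ∂μ) (K / (1 - γ) ^ 2)
    -- Convexity of the square, with weights `γ` and `1 - γ` at `f k` and `b k / (1 - γ)`. This
    -- avoids cross terms between the past error and the new noise.
    have hpt : ∀ ω, f (k + 1) ω ^ 2 ≤ γ * f k ω ^ 2 + b k ω ^ 2 / (1 - γ) := fun ω => by
      rw [hf, ← sub_le_iff_le_add', le_div_iff₀ hg]
      nlinarith [mul_nonneg hγ0 (sq_nonneg ((1 - γ) * f k ω - b k ω))]
    have h1 := (hmem k).integrable_sq.const_mul γ
    have h2 := (hb k).integrable_sq.div_const (1 - γ)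
    calc ∫ ω, f (k + 1) ω ^ 2 ∂μ
        ≤ ∫ ω, γ * f k ω ^ 2 + b k ω ^ 2 / (1 - γ) ∂μ :=
          integral_mono (hmem (k + 1)).integrable_sq (h1.add h2) hpt
      _ = γ * ∫ ω, f k ω ^ 2 ∂μ + (∫ ω, b k ω ^ 2 ∂μ) / (1 - γ) := by
          rw [integral_add h1 h2, integral_const_mul, integral_div]
      _ ≤ γ * B + K / (1 - γ) := by gcongr; exact hK k
      _ ≤ γ * B + (1 - γ) * B := by
          gcongr
          have h3 : K / (1 - γ) ^ 2 ≤ B := le_max_right _ _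
          calc K / (1 - γ) = (1 - γ) * (K / (1 - γ) ^ 2) := by field_simp
            _ ≤ _ := by gcongr
      _ = B := by ring

end Moments

theorem sqrt_dotProduct_self_eq_norm {n : ℕ} (z : EuclideanSpace ℝ (Fin n)) :
    √(z.ofLp ⬝ᵥ z.ofLp) = ‖z‖ := by
  rw [EuclideanSpace.norm_eq]
  simp [dotProduct, sq]

theorem exists_sqrt_quadVal_le {n : ℕ} (M : Matrix (Fin n) (Fin n) ℝ) :
    ∃ c, 0 ≤ c ∧ ∀ z : EuclideanSpace ℝ (Fin n), √(M.quadVal z.ofLp) ≤ c * ‖z‖ := by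
  obtain ⟨c, hc, h⟩ := Matrix.exists_quadVal_le M
  refine ⟨√c, Real.sqrt_nonneg _, fun z => ?_⟩
  rw [← sqrt_dotProduct_self_eq_norm, ← Real.sqrt_mul hc.le]
  exact Real.sqrt_le_sqrt (h _)

namespace ETFilter

open NetState

variable {ι : Type*} [Fintype ι] {n : ℕ} {m : ι → ℕ} {F : ETFilter ι n m}

namespace Admissible

variable (hF : F.Admissible)
include hF

/-- Consensus mixes the nodes, so a single bound must serve them all; hence the sum over all
sensors. -/
theorem exists_errBound_correctStep :
    ∃ r : ι → ℝ, (∀ i, 0 ≤ r i) ∧ ∀ (s : NetState ι n), s.Nondeg →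
      ∀ (x : Fin n → ℝ) (v z : (i : ι) → EuclideanSpace ℝ (Fin (m i))) (M : ℝ),
      (∀ i ∈ F.S, z i = WithLp.toLp 2 (F.C i *ᵥ x) + v i) → (∀ i, (s.cur i).ErrBound x M) →
      ∀ i, ((s.correctStep F.S F.C F.R z).cur i).ErrBound x
        (M + ∑ j ∈ F.S, r j * ‖v j‖) := by
  choose r hr h using fun i => exists_sqrt_quadVal_le (F.R i)⁻¹
  refine ⟨r, hr, fun s hs x v z M hz hM i => ?_⟩
  have hnn : ∀ j ∈ F.S, 0 ≤ r j * ‖v j‖ := fun j _ => mul_nonneg (hr j) (norm_nonneg _)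
  simp only [correctStep]
  split_ifs with hi
  · rw [hz i hi]
    refine ((hM i).correct (hs.cur i) (hF.posDef_R i hi) (v i)).mono ?_
    gcongr
    exact (h i (v i)).trans (Finset.single_le_sum hnn hi)
  · exact (hM i).mono (le_add_of_nonneg_right (Finset.sum_nonneg hnn))

/-- The weighted estimation errors satisfy a contractive recursion along every path. -/
theorem exists_errBound_recursion (hA : IsUnit F.A) (hL : 1 ≤ F.L)
    (hobs : IsObservable F.A (stackedOutput F.S F.C)) (hconn : StronglyConnected F.G) :
    ∃ (γ c d : ℝ) (r a : ι → ℝ), 0 ≤ γ ∧ γ < 1 ∧ ∀ (x w : ℕ → EuclideanSpace ℝ (Fin n))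
      (v y : ℕ → (i : ι) → EuclideanSpace ℝ (Fin (m i))) (M : ℕ → ℝ),
      (∀ k, x (k + 1) = WithLp.toLp 2 (F.A *ᵥ (x k).ofLp) + w k) →
      (∀ i ∈ F.S, ∀ k, y k i = WithLp.toLp 2 (F.C i *ᵥ (x k).ofLp) + v k i) →
      M 0 = ∑ j, a j * ‖(F.init.cur j).mean - x 0‖ + ∑ j ∈ F.S, r j * ‖v 0 j‖ →
      (∀ k, M (k + 1) = γ * M k + (d + c * ‖w k‖ + ∑ j ∈ F.S, r j * ‖v (k + 1) j‖)) →
      ∀ k i, ((F.posterior y k).cur i).ErrBound (x k).ofLp (M k) := by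
  obtain ⟨α, hα, hlow⟩ := hF.exists_le_quadVal_posterior hA hL hobs hconn
  obtain ⟨ε, hε, hcons⟩ := exists_le_quadVal_iterate_consensusStep_self (n := n) hF.tau_pos
    hF.delta_ge hF.weights F.L
  -- Prediction acts on the pairs after consensus, which retain the fraction `ε` of the posterior
  -- bound `α`.
  obtain ⟨γ, c, hγ0, hγ1, hc, hpred⟩ := InfoPair.exists_errBound_predict F.A hF.posDef_Q
    (mul_pos hε hα)
  obtain ⟨r, hr, hcorr⟩ := hF.exists_errBound_correctStep
  choose a ha hinit using fun i => exists_sqrt_quadVal_le (F.init.cur i).Om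
  -- The constant input is the cost `L √(2τ)` of the consensus steps, contracted by the subsequent
  -- prediction.
  refine ⟨γ, c, γ * (F.L * √(2 * F.τ)), r, a, hγ0, hγ1, fun x w v y M hx hy hM0 hM k => ?_⟩
  induction k with
  | zero =>
    rw [hM0]
    refine hcorr F.init hF.nondeg_init (x 0).ofLp (v 0) (y 0) _ (fun i hi => hy i hi 0) fun i => ?_
    refine (InfoPair.errBound_self (hF.nondeg_init.cur i) _).mono ?_
    refine (hinit i ((F.init.cur i).mean - x 0)).trans ?_
    exact Finset.single_le_sum (f := fun j => a j * ‖(F.init.cur j).mean - x 0‖)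
      (fun j _ => mul_nonneg (ha j) (norm_nonneg _)) (Finset.mem_univ i)
  | succ k ih =>
    have hs := hF.nondeg_posterior y k
    have hprior : ∀ i, ((F.prior y (k + 1)).cur i).ErrBound (x (k + 1)).ofLp
        (γ * (M k + F.L * √(2 * F.τ)) + c * ‖w k‖) := fun i => by
      rw [hx, prior_succ_cur, ← sqrt_dotProduct_self_eq_norm]
      refine hpred _ ((hF.nondeg_consensus y k).cur i) (fun u => ?_) _ _ _
        (errBound_iterate_consensusStep hF.tau_pos hF.delta_ge hF.weights hs ih F.L i)
      refine le_trans ?_ (hcons _ hs i u)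
      rw [mul_assoc]
      exact mul_le_mul_of_nonneg_left (hlow y k i u) hε.le
    intro i
    refine (hcorr _ (hF.nondeg_prior y (k + 1)) _ (v (k + 1)) (y (k + 1)) _
      (fun i hi => hy i hi (k + 1)) hprior i).mono (le_of_eq ?_)
    rw [hM]
    ring

end Admissible

end ETFilter

/-- A bound on the weighted estimation error that is driven by the noise norms only. -/
def errorMajorant {ι Ω : Type*} [Fintype ι] {n : ℕ} {m : ι → ℕ} (S : Finset ι)
    (γ c d : ℝ) (r a : ι → ℝ) (z : ι → EuclideanSpace ℝ (Fin n))
    (x₀ : Ω → EuclideanSpace ℝ (Fin n)) (w : ℕ → Ω → EuclideanSpace ℝ (Fin n))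
    (v : (i : ι) → ℕ → Ω → EuclideanSpace ℝ (Fin (m i))) : ℕ → Ω → ℝ
  | 0 => fun ω => ∑ j, a j * ‖z j - x₀ ω‖ + ∑ j ∈ S, r j * ‖v j 0 ω‖
  | k + 1 => fun ω => γ * errorMajorant S γ c d r a z x₀ w v k ω +
      (d + c * ‖w k ω‖ + ∑ j ∈ S, r j * ‖v j (k + 1) ω‖)

theorem memLp_sum_mul_norm {ι Ω : Type*} {m : ι → ℕ} [MeasurableSpace Ω] {μ : Measure Ω}
    {S : Finset ι} {R : (i : ι) → Matrix (Fin (m i)) (Fin (m i)) ℝ} (r : ι → ℝ)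
    {v : (i : ι) → Ω → EuclideanSpace ℝ (Fin (m i))}
    (hv : ∀ i ∈ S, HasLaw (v i) (multivariateGaussian 0 (R i)) μ) :
    MemLp (fun ω => ∑ j ∈ S, r j * ‖v j ω‖) 2 μ :=
  memLp_finsetSum _ fun j hj => (memLp_of_hasLaw_gaussian (hv j hj)).norm.const_mul _

theorem exists_integral_sq_errorMajorant_le {ι Ω : Type*} [Fintype ι] {n : ℕ} {m : ι → ℕ}
    [MeasurableSpace Ω] {μ : Measure Ω} [IsProbabilityMeasure μ] {S : Finset ι}
    {γ : ℝ} (hγ0 : 0 ≤ γ) (hγ1 : γ < 1) (c d : ℝ) (r a : ι → ℝ)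
    (z : ι → EuclideanSpace ℝ (Fin n)) {x₀ : Ω → EuclideanSpace ℝ (Fin n)}
    {w : ℕ → Ω → EuclideanSpace ℝ (Fin n)}
    {v : (i : ι) → ℕ → Ω → EuclideanSpace ℝ (Fin (m i))}
    {x₀mean : EuclideanSpace ℝ (Fin n)} {P₀ Q : Matrix (Fin n) (Fin n) ℝ}
    {R : (i : ι) → Matrix (Fin (m i)) (Fin (m i)) ℝ}
    (hx₀ : HasLaw x₀ (multivariateGaussian x₀mean P₀) μ)
    (hw : ∀ k, HasLaw (w k) (multivariateGaussian 0 Q) μ)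
    (hv : ∀ i ∈ S, ∀ k, HasLaw (v i k) (multivariateGaussian 0 (R i)) μ) :
    (∀ k, MemLp (errorMajorant S γ c d r a z x₀ w v k) 2 μ) ∧
      ∃ B, ∀ k, ∫ ω, errorMajorant S γ c d r a z x₀ w v k ω ^ 2 ∂μ ≤ B := by
  have hwL := fun k => memLp_of_hasLaw_gaussian (hw k)
  have hvL : ∀ k, MemLp (fun ω => ∑ j ∈ S, r j * ‖v j k ω‖) 2 μ := fun k =>
    memLp_sum_mul_norm r fun j hj => hv j hj k
  have h0 : MemLp (errorMajorant S γ c d r a z x₀ w v 0) 2 μ := by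
    refine MemLp.add (memLp_finsetSum _ fun j _ => ?_) (hvL 0)
    exact ((memLp_const (z j)).sub (memLp_of_hasLaw_gaussian hx₀)).norm.const_mul _
  have hb : ∀ k, MemLp (fun ω => d + c * ‖w k ω‖ + ∑ j ∈ S, r j * ‖v j (k + 1) ω‖) 2 μ :=
    fun k => ((memLp_const d).add ((hwL k).norm.const_mul c)).add (hvL (k + 1))
  have hf : ∀ k, errorMajorant S γ c d r a z x₀ w v (k + 1) = fun ω =>
      γ * errorMajorant S γ c d r a z x₀ w v k ω +
        (d + c * ‖w k ω‖ + ∑ j ∈ S, r j * ‖v j (k + 1) ω‖) := fun k => rfl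
  refine ⟨memLp_recursion hf h0 hb, exists_integral_sq_le_of_recursion hγ0 hγ1 hf h0 hb
    -- From `(a + b + c)² ≤ 3 (a² + b² + c²)` and Cauchy-Schwarz for the sum over sensors; it is
    -- free of `k` because the noise laws are.
    (K := 3 * d ^ 2 + (3 * c ^ 2 * ∫ t, ‖t‖ ^ 2 ∂multivariateGaussian 0 Q +
      ∑ j ∈ S, 3 * S.card * r j ^ 2 * ∫ t, ‖t‖ ^ 2 ∂multivariateGaussian 0 (R j)))
    fun k => ?_⟩
  have hpt : ∀ ω, (d + c * ‖w k ω‖ + ∑ j ∈ S, r j * ‖v j (k + 1) ω‖) ^ 2 ≤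
      3 * d ^ 2 + (3 * c ^ 2 * ‖w k ω‖ ^ 2 +
        ∑ j ∈ S, 3 * S.card * r j ^ 2 * ‖v j (k + 1) ω‖ ^ 2) := fun ω => by
    have h1 := sq_sum_le_card_mul_sum_sq (s := S) (f := fun j => r j * ‖v j (k + 1) ω‖)
    have h2 : ∑ j ∈ S, 3 * S.card * r j ^ 2 * ‖v j (k + 1) ω‖ ^ 2 =
        3 * (S.card * ∑ j ∈ S, (r j * ‖v j (k + 1) ω‖) ^ 2) := by
      simp only [Finset.mul_sum]
      exact Finset.sum_congr rfl fun j _ => by ring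
    rw [h2]
    nlinarith [sq_nonneg (d - c * ‖w k ω‖),
      sq_nonneg (d - ∑ j ∈ S, r j * ‖v j (k + 1) ω‖),
      sq_nonneg (c * ‖w k ω‖ - ∑ j ∈ S, r j * ‖v j (k + 1) ω‖)]
  have hvi : ∀ j ∈ S, Integrable
      (fun ω => 3 * S.card * r j ^ 2 * ‖v j (k + 1) ω‖ ^ 2) μ := fun j hj =>
    ((memLp_of_hasLaw_gaussian (hv j hj (k + 1))).norm.integrable_sq).const_mul _
  have hwi : Integrable (fun ω => 3 * c ^ 2 * ‖w k ω‖ ^ 2) μ :=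
    (hwL k).norm.integrable_sq.const_mul _
  have hsi := integrable_finsetSum S hvi
  have hadd : Integrable (fun ω => 3 * c ^ 2 * ‖w k ω‖ ^ 2 +
      ∑ j ∈ S, 3 * S.card * r j ^ 2 * ‖v j (k + 1) ω‖ ^ 2) μ := hwi.add hsi
  have hall : Integrable (fun ω => 3 * d ^ 2 + (3 * c ^ 2 * ‖w k ω‖ ^ 2 +
      ∑ j ∈ S, 3 * S.card * r j ^ 2 * ‖v j (k + 1) ω‖ ^ 2)) μ := (integrable_const _).add hadd
  refine (integral_mono (hb k).integrable_sq hall hpt).trans (le_of_eq ?_)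
  rw [integral_add (integrable_const _) hadd, integral_const, probReal_univ, one_smul,
    integral_add hwi hsi, integral_finsetSum S hvi, integral_const_mul,
    integral_norm_sq_of_hasLaw_gaussian (hw k)]
  congr 2
  refine Finset.sum_congr rfl fun j hj => ?_
  rw [integral_const_mul, integral_norm_sq_of_hasLaw_gaussian (hv j hj (k + 1))]

end MeanSquare

/-! ### The mean-square bound. -/

theorem theorem1 {ι : Type*} [Fintype ι] {n : ℕ} {m : ι → ℕ}
    {Ω : Type*} [MeasurableSpace Ω] (μ : Measure Ω) [IsProbabilityMeasure μ]
    (F : ETFilter ι n m)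
    (x₀mean : EuclideanSpace ℝ (Fin n)) (P₀ : Matrix (Fin n) (Fin n) ℝ)
    (x w : ℕ → Ω → EuclideanSpace ℝ (Fin n))
    (v y : (i : ι) → ℕ → Ω → EuclideanSpace ℝ (Fin (m i)))
    -- linear-Gaussian system and measurements
    (hP₀ : P₀.PosDef) (hQ : F.Q.PosDef) (hR : ∀ i ∈ F.S, (F.R i).PosDef)
    (hx₀ : HasLaw (x 0) (multivariateGaussian x₀mean P₀) μ)
    (hw : ∀ k, HasLaw (w k) (multivariateGaussian 0 F.Q) μ)
    (hv : ∀ i ∈ F.S, ∀ k, HasLaw (v i k) (multivariateGaussian 0 (F.R i)) μ)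
    (hindep : iIndepFun (noiseFamily F.S (x 0) w v) μ)
    (hx : ∀ k ω, x (k + 1) ω = WithLp.toLp 2 (F.A *ᵥ (x k ω).ofLp) + w k ω)
    (hy : ∀ i ∈ F.S, ∀ k ω, y i k ω = WithLp.toLp 2 (F.C i *ᵥ (x k ω).ofLp) + v i k ω)
    -- the assumptions on the system and the network
    (hA : IsUnit F.A)
    (hobs : IsObservable F.A (stackedOutput F.S F.C))
    (hconn : StronglyConnected F.G)
    -- the parameters and the initialization of the filter
    (hW : IsConsensusWeights F.G F.W)
    (hL : 1 ≤ F.L) (hτ : 0 < F.τ) (hδ : deltaStar F.τ ≤ F.δ)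
    (hinit : ∀ i, (F.init.cur i).Om.PosDef)
    (hinit_ref : ∀ i, ∀ r ∈ F.init.ref i, r.Om.PosDef)
    (i : ι) :
    limsup (fun k => ∫⁻ ω, ‖F.estimate (fun t j => y j t ω) k i - x k ω‖ₑ ^ 2 ∂μ) atTop < ⊤ := by
  have hF : F.Admissible := ⟨hQ, hR, hW, hτ, hδ, hinit, hinit_ref⟩
  obtain ⟨α, hα, hlow⟩ := hF.exists_le_quadVal_posterior hA hL hobs hconn
  obtain ⟨γ, c, d, r, a, hγ0, hγ1, hrec⟩ := hF.exists_errBound_recursion hA hL hobs hconn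
  obtain ⟨hmem, B, hB⟩ := exists_integral_sq_errorMajorant_le hγ0 hγ1 c d r a
    (fun j => (F.init.cur j).mean) hx₀ hw hv
  set M := errorMajorant F.S γ c d r a (fun j => (F.init.cur j).mean) (x 0) w v with hMdef
  have hpt : ∀ k ω, ‖F.estimate (fun t j => y j t ω) k i - x k ω‖ₑ ^ 2 ≤
      ENNReal.ofReal (α⁻¹ * M k ω ^ 2) := fun k ω => by
    have h := (hrec (fun k => x k ω) (fun k => w k ω) (fun k j => v j k ω)
      (fun k j => y j k ω) (fun k => M k ω) (fun k => hx k ω) (fun j hj k => hy j hj k ω) rfl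
      (fun k => rfl) k i).norm_sq_le ((hF.nondeg_posterior _ k).cur i) hα (hlow _ k i)
    rw [← ofReal_norm, ← ENNReal.ofReal_pow (norm_nonneg _)]
    exact ENNReal.ofReal_le_ofReal h
  have hbound : ∀ k, ∫⁻ ω, ‖F.estimate (fun t j => y j t ω) k i - x k ω‖ₑ ^ 2 ∂μ ≤
      ENNReal.ofReal (α⁻¹ * B) := fun k => by
    -- Monotonicity of the lower integral requires no measurability of the estimates, whose
    -- transmission tests depend on the data; only the majorant has to be integrable.
    refine (lintegral_mono (hpt k)).trans ?_
    rw [← ofReal_integral_eq_lintegral_ofReal ((hmem k).integrable_sq.const_mul _)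
      (Eventually.of_forall fun ω => by positivity), integral_const_mul]
    exact ENNReal.ofReal_le_ofReal (mul_le_mul_of_nonneg_left (hB k) (inv_nonneg.2 hα.le))
  exact (limsup_le_of_le (by isBoundedDefault) (Eventually.of_forall hbound)).trans_lt
    ENNReal.ofReal_lt_top
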